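/- **Theorem 1.** Let $M$ be a parametric model with parameter space a measurable set $\Theta\subseteq\mathbb R^p$, probability densities $f(\cdot\mid\theta)$, $\theta\in\Theta$, with respect to a measure $\nu$ on the observation space, and a measurable, possibly improper, prior density $g\ge 0$ on $\Theta$ (for instance the flat prior $g=1$). For a sample $\mathbf y=(y_1,\dots,y_n)$ put $$L(\theta\mid\mathbf y)=\prod_{i=1}^n f(y_i\mid\theta),\qquad P(\mathbf y\mid M)=\int_\Theta L(\theta\mid\mathbf y)\,g(\theta)\,d\theta .$$ Let $y_1,y_2,\dots$ be i.i.d. with density $f(\cdot\mid\theta_0)$, $\theta_0\in\Theta$, let $P_{\theta}$ be the distribution with density $f(\cdot\mid\theta)$, and assume the following regularity conditions, where "a.e. $y$" refers to $P_{\theta_0}$. 1. If $\theta\in\Theta$ and $P_\theta=P_{\theta_0}$, then $\theta=\theta_0$. 2. For a.e. $y$, $f(y\mid\theta)>0$ for all $\theta\in\Theta$, and $\theta\mapsto f(y\mid\theta)$ is continuous on $\Theta$. 3. There are an open ball $B\subseteq\Theta$ centred at $\theta_0$ and a $P_{\theta_0}$-integrable function $H$ such that for a.e. $y$ the function $\theta\mapsto\log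 f(y\mid\theta)$ is $C^2$ on $B$ with $\|\nabla^2_\theta\log f(y\mid\theta)\|\le H(y)$ for all $\theta\in B$. 4. The Fisher information matrix $I(\theta_0)=-\mathbb E_{\theta_0}\big[\nabla^2_\theta\log f(y_1\mid\theta_0)\big]$ is positive definite. 5. (Wald's conditions) There are a compact set $K\subseteq\Theta$, a $P_{\theta_0}$-integrable function $G$ with $\log\frac{f(y\mid\theta)}{f(y\mid\theta_0)}\le G(y)$ for a.e. $y$ and all $\theta\in K$, and an integer $k\ge1$ and a $P_{\theta_0}^{\otimes k}$-integrable function $G_k$ with $\int G_k\,dP_{\theta_0}^{\otimes k}<0$ and $\sum_{i=1}^k\log\frac{f(y_i\mid\theta)}{f(y_i\mid\theta_0)}\le G_k(y_1,\dots,y_k)$ for $P_{\theta_0}^{\otimes k}$-a.e. $(y_1,\dots,y_k)$ and all $\theta\in\Theta\setminus K$. 6. $g$ is continuous at $\theta_0$ and $g(\theta_0)>0$, and for some $m\ge0$ one has $P(y_1,\dots,y_m\mid M)<\infty$ almost surely. Let $\hat\theta=\hat\theta_n$ be a maximum likelihood estimate, that is, with probability tending to $1$ as $n\to\infty$, $\hat\theta_n\in\Theta$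 maximizes $L(\cdot\mid y_1,\dots,y_n)$ over $\Theta$. Then, with probability tending to $1$, $0<P(\mathbf y\mid M)<\infty$, and $$\log P(\mathbf y\mid M)=\log L(\hat\theta\mid\mathbf y)-\frac p2\log n+O_p(1)\qquad(n\to\infty).$$ -/

import Mathlib

open MeasureTheory ProbabilityTheory Filter Topology

noncomputable section

/-- A dominated parametric model with `p` real parameters for one observation in `Y`, together
with a (possibly improper) prior density on the parameter space. The flat prior is
`prior = fun _ => 1`. -/
structure BayesModel (Y : Type*) [MeasurableSpace Y] (p : ℕ) where
  /-- the dominating measure on the observation space -/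
  ref : Measure Y
  /-- the parameter space -/
  params : Set (EuclideanSpace ℝ (Fin p))
  /-- `density θ y` is the density `f(y | θ)` of one observation -/
  density : EuclideanSpace ℝ (Fin p) → Y → ℝ
  /-- `prior θ` is the prior density `g(θ)` with respect to Lebesgue measure -/
  prior : EuclideanSpace ℝ (Fin p) → ℝ
  measurableSet_params : MeasurableSet params
  measurable_density : ∀ θ ∈ params, Measurable (density θ)
  density_nonneg : ∀ θ ∈ params, ∀ y, 0 ≤ density θ y
  lintegral_density : ∀ θ ∈ params, ∫⁻ y, ENNReal.ofReal (density θ y) ∂ref = 1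
  measurable_prior : Measurable prior
  prior_nonneg : ∀ θ ∈ params, 0 ≤ prior θ

namespace BayesModel

variable {Y : Type*} [MeasurableSpace Y] {p : ℕ} (M : BayesModel Y p)

/-- The law of one observation under the parameter `θ`. -/
def law (θ : EuclideanSpace ℝ (Fin p)) : Measure Y :=
  M.ref.withDensity fun y => ENNReal.ofReal (M.density θ y)

/-- The likelihood of an i.i.d. sample of size `n`. -/
def likelihood {n : ℕ} (y : Fin n → Y) (θ : EuclideanSpace ℝ (Fin p)) : ℝ :=
  ∏ i, M.density θ (y i)

/-- The marginal likelihood of the model, an element of `[0, ∞]`: the integral over the parameter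
space of likelihood times prior. -/
def marginalLikelihood {n : ℕ} (y : Fin n → Y) : ENNReal :=
  ∫⁻ θ in M.params, ENNReal.ofReal (M.likelihood y θ * M.prior θ)

/-- `θ` is a maximum likelihood estimate for the sample `y`. -/
def IsMLE {n : ℕ} (y : Fin n → Y) (θ : EuclideanSpace ℝ (Fin p)) : Prop :=
  θ ∈ M.params ∧ IsMaxOn (M.likelihood y) M.params θ

/-- The log-likelihood of a single observation, as a function of the parameter. -/
def logDensity (y : Y) (θ : EuclideanSpace ℝ (Fin p)) : ℝ :=
  Real.log (M.density θ y)

/-- The second derivative of the log-likelihood of a single observation in the parameter. -/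
def hessLogDensity (y : Y) (θ : EuclideanSpace ℝ (Fin p)) :
    EuclideanSpace ℝ (Fin p) →L[ℝ] EuclideanSpace ℝ (Fin p) →L[ℝ] ℝ :=
  fderiv ℝ (fderiv ℝ (M.logDensity y)) θ

/-- The Fisher information matrix of a single observation: minus the expectation of the matrix of
second partial derivatives of the log-likelihood. -/
def fisherInformation (θ : EuclideanSpace ℝ (Fin p)) : Matrix (Fin p) (Fin p) ℝ :=
  Matrix.of fun m l => -∫ y, M.hessLogDensity y θ (EuclideanSpace.single m 1)
    (EuclideanSpace.single l 1) ∂(M.law θ)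

/-- Regularity conditions on the model at the true parameter `θ₀`. They concern only the densities
and the prior, not the sample. -/
structure RegularAt (θ₀ : EuclideanSpace ℝ (Fin p)) : Prop where
  /-- `θ₀` is a parameter -/
  mem_params : θ₀ ∈ M.params
  /-- `θ₀` is identifiable -/
  identifiable : ∀ θ ∈ M.params, M.law θ = M.law θ₀ → θ = θ₀
  /-- the densities have common support -/
  density_pos : ∀ᵐ y ∂(M.law θ₀), ∀ θ ∈ M.params, 0 < M.density θ y
  /-- the densities are continuous in the parameter -/
  density_continuousOn :
    ∀ᵐ y ∂(M.law θ₀), ContinuousOn (fun θ => M.density θ y) M.params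
  /-- in a ball around the interior point `θ₀`, the log-density is twice continuously
  differentiable in the parameter, with an integrable bound for the second derivative -/
  smooth : ∃ r > 0, Metric.ball θ₀ r ⊆ M.params ∧
    ∃ H : Y → ℝ, Integrable H (M.law θ₀) ∧
      ∀ᵐ y ∂(M.law θ₀), ContDiffOn ℝ 2 (M.logDensity y) (Metric.ball θ₀ r) ∧
        ∀ θ ∈ Metric.ball θ₀ r, ‖M.hessLogDensity y θ‖ ≤ H y
  /-- the Fisher information is nondegenerate -/
  fisher_posDef : (M.fisherInformation θ₀).PosDef
  /-- Wald's integrability conditions: for some compact set `K` of parameters, the log-likelihood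
  ratio of one observation against `θ₀` has an integrable upper bound on `K`, and that of some
  fixed number `k` of independent observations has, off `K`, an upper bound with negative mean.
  (The second part is void if the parameter space is compact.) -/
  wald : ∃ K : Set (EuclideanSpace ℝ (Fin p)), IsCompact K ∧ K ⊆ M.params ∧
    (∃ G : Y → ℝ, Integrable G (M.law θ₀) ∧
      ∀ᵐ y ∂(M.law θ₀), ∀ θ ∈ K, M.logDensity y θ - M.logDensity y θ₀ ≤ G y) ∧
    (∃ k : ℕ, 0 < k ∧ ∃ G : (Fin k → Y) → ℝ,
      Integrable G (Measure.pi fun _ => M.law θ₀) ∧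
      ∫ y, G y ∂(Measure.pi fun _ => M.law θ₀) < 0 ∧
      ∀ᵐ y ∂(Measure.pi fun _ => M.law θ₀), ∀ θ ∈ M.params \ K,
        ∑ i, (M.logDensity (y i) θ - M.logDensity (y i) θ₀) ≤ G y)
  /-- the prior density is continuous and positive at `θ₀` -/
  prior_continuousAt : ContinuousAt M.prior θ₀
  prior_pos : 0 < M.prior θ₀
  /-- the posterior is proper for some sample size `m` (with `m = 0` if the prior is proper) -/
  marginal_finite : ∃ m : ℕ, ∀ᵐ y : Fin m → Y ∂(Measure.pi fun _ => M.law θ₀),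
    M.marginalLikelihood y < ⊤

end BayesModel

/-- `X n = O_p(1)` as `n → ∞`. -/
def BoundedInProbability {Ω : Type*} [MeasurableSpace Ω] (μ : Measure Ω) (X : ℕ → Ω → ℝ) : Prop :=
  ∀ ε : ENNReal, 0 < ε → ∃ C : ℝ, ∀ᶠ n in atTop, μ {ω | C < |X n ω|} ≤ ε

end

/-! The marginal likelihood is pinned between two constant multiples of `L(θ₀) n^(-p/2)`, and `log
L(θhat) - log L(θ₀)` is shown to be bounded in probability. Since only an `O_p(1)` error is claimed,
one-sided quadratic bounds suffice: neither a limit of Hessians along the sample nor asymptotic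
normality of the estimate is needed.

Let `S` be the score of the sample at `θ₀`. With probability tending to one, the log-likelihood
ratio at `θ₀ + h` lies, for small `h`, between `S h - C n ‖h‖²` (`highProbability_le_sum_logRatio`)
and `S h - c n ‖h‖²` (`exists_highProbability_sum_logRatio_le_of_norm_lt`), and outside a given ball
it is at most `-c n` (`highProbability_sum_logRatio_le_of_le_norm`). By Chebyshev, `‖S‖ ≤ A √n` up
to small probability. On these events, completing the square bounds the integral near `θ₀` by a
Gaussian integral of order `n^(-p/2)`. The ball of radius `1/√n` gives a lower bound of the same
order. The rest of the parameter space is exponentially negligible once `m` observations have been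
set aside to make the integral finite. A maximizer must lie in the ball, where it gains at most
`A²/(2c)`.

Both upper bounds come from one compactness argument: `exists_integrable_envelope` gives a common
bound with negative mean near each point, and the law of large numbers applies to that bound. Away
from `θ₀` the negative mean comes from `𝔼[exp X] ≤ 1` (`exists_integral_max_neg`). Near `θ₀` the
argument is run on second-order difference quotients, whose limit is half the Hessian, with negative
mean by positivity of the Fisher information. That the score is centred and square integrable is not
assumed; it follows from `𝔼[exp X] ≤ 1` and the integrable Hessian bound
(`memLp_two_and_integral_eq_zero_of_exp`). -/

/-! ### Events whose probability tends to one. -/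

section HighProbability

variable {Ω : Type*} [MeasurableSpace Ω] {μ : Measure Ω}

/-- The events `{ω | A n ω}` have probability tending to one (in outer measure). -/
def HighProbability (μ : Measure Ω) (A : ℕ → Ω → Prop) : Prop :=
  Tendsto (fun n => μ {ω | ¬ A n ω}) atTop (𝓝 0)

namespace HighProbability

variable {A B : ℕ → Ω → Prop}

/-- Only monotonicity of outer measure is used, so events quantifying over uncountably many
parameters need no measurability. -/
lemma mono_ae (hA : HighProbability μ A) (h : ∀ᶠ n in atTop, ∀ᵐ ω ∂μ, A n ω → B n ω) :
    HighProbability μ B := by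
  refine tendsto_of_tendsto_of_tendsto_of_le_of_le' tendsto_const_nhds hA
    (Eventually.of_forall fun _ => zero_le) ?_
  filter_upwards [h] with n hn
  refine measure_mono_ae ?_
  filter_upwards [hn] with ω hω hB hA'
  exact hB (hω hA')

lemma mono (hA : HighProbability μ A) (h : ∀ n ω, A n ω → B n ω) : HighProbability μ B :=
  hA.mono_ae (Eventually.of_forall fun n => ae_of_all _ (h n))

lemma and (hA : HighProbability μ A) (hB : HighProbability μ B) :
    HighProbability μ fun n ω => A n ω ∧ B n ω := by
  have h := Tendsto.add hA hB
  rw [add_zero] at h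
  refine tendsto_of_tendsto_of_tendsto_of_le_of_le tendsto_const_nhds h
    (fun _ => zero_le) fun n => ?_
  refine (measure_mono fun ω hω => ?_).trans (measure_union_le _ _)
  simp only [Set.mem_ofPred_eq, Set.mem_union] at hω ⊢
  tauto

lemma of_ae (h : ∀ᶠ n in atTop, ∀ᵐ ω ∂μ, A n ω) : HighProbability μ A := by
  refine tendsto_const_nhds.congr' ?_
  filter_upwards [h] with n hn
  exact (ae_iff.1 hn).symm

lemma comp_tendsto (hA : HighProbability μ A) {u : ℕ → ℕ} (hu : Tendsto u atTop atTop) :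
    HighProbability μ fun n => A (u n) :=
  Tendsto.comp (g := fun n => μ {ω | ¬ A n ω}) hA hu

lemma forall_finset {ι : Type*} (s : Finset ι) {C : ι → ℕ → Ω → Prop}
    (h : ∀ i ∈ s, HighProbability μ (C i)) : HighProbability μ fun n ω => ∀ i ∈ s, C i n ω := by
  classical
  induction s using Finset.induction_on with
  | empty => exact of_ae (Eventually.of_forall fun n => ae_of_all _ (by simp))
  | insert a s ha ih =>
    refine ((h a (by simp)).and (ih fun i hi => h i (by simp [hi]))).mono fun n ω hω i hi => ?_
    rcases Finset.mem_insert.1 hi with rfl | hi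
    exacts [hω.1, hω.2 i hi]

lemma of_tendsto_ae_lt [IsFiniteMeasure μ] {X : ℕ → Ω → ℝ} (hX : ∀ n, AEStronglyMeasurable (X n) μ)
    {l a : ℝ} (hl : l < a) (h : ∀ᵐ ω ∂μ, Tendsto (fun n => X n ω) atTop (𝓝 l)) :
    HighProbability μ fun n ω => X n ω ≤ a := by
  have hm := tendstoInMeasure_of_tendsto_ae (g := fun _ => l) hX h
  rw [tendstoInMeasure_iff_dist] at hm
  refine tendsto_of_tendsto_of_tendsto_of_le_of_le tendsto_const_nhds (hm (a - l) (by linarith))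
    (fun _ => zero_le) fun n => measure_mono fun ω hω => ?_
  simp only [Set.mem_ofPred_eq, not_le, Real.dist_eq] at hω ⊢
  exact le_trans (by linarith) (le_abs_self _)

/-- A one-sided law of large numbers. -/
lemma sum_le_of_integral_lt [IsFiniteMeasure μ] {X : ℕ → Ω → ℝ} (hint : Integrable (X 0) μ)
    (hindep : Pairwise fun i j => IndepFun (X i) (X j) μ)
    (hident : ∀ i, IdentDistrib (X i) (X 0) μ μ) {a : ℝ} (ha : μ[X 0] < a) :
    HighProbability μ fun n ω => ∑ i ∈ Finset.range n, X i ω ≤ a * n := by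
  have hX : ∀ i, Integrable (X i) μ := fun i => (hident i).integrable_iff.2 hint
  have h := of_tendsto_ae_lt (X := fun n ω => (∑ i ∈ Finset.range n, X i ω) / n)
    (fun n => (((integrable_finsetSum _ fun i _ => hX i).div_const _)).aestronglyMeasurable) ha
    (strong_law_ae_real X hint hindep hident)
  refine h.mono_ae ?_
  filter_upwards [eventually_gt_atTop 0] with n hn
  refine ae_of_all _ fun ω hω => ?_
  exact (div_le_iff₀ (by positivity)).1 hω

lemma le_mul_natCast [IsFiniteMeasure μ] {X : Ω → ℝ} (hX : AEStronglyMeasurable X μ) {a : ℝ}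
    (ha : 0 < a) : HighProbability μ fun n ω => X ω ≤ a * n := by
  have h := of_tendsto_ae_lt (μ := μ) (X := fun n ω => X ω / (n : ℝ))
    (fun n => (hX.aemeasurable.div_const _).aestronglyMeasurable) ha
    (ae_of_all _ fun ω => tendsto_const_div_atTop_nhds_zero_nat _)
  refine h.mono_ae ?_
  filter_upwards [eventually_gt_atTop 0] with n hn
  refine ae_of_all _ fun ω hω => ?_
  exact (div_le_iff₀ (by positivity)).1 hω

end HighProbability

end HighProbability

/-! ### Independent samples and laws of large numbers. -/

section Sample

variable {Ω Y : Type*} [MeasurableSpace Ω] [MeasurableSpace Y] {μ : Measure Ω} {P : Measure Y}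

/-- `y 0, y 1, …` are independent observations with the common law `P`. -/
structure IsIIDSample (μ : Measure Ω) (P : Measure Y) (y : ℕ → Ω → Y) : Prop where
  measurable : ∀ i, Measurable (y i)
  indep : iIndepFun y μ
  map_eq : ∀ i, μ.map (y i) = P

namespace IsIIDSample

variable {y : ℕ → Ω → Y}

lemma shift (h : IsIIDSample μ P y) (m : ℕ) : IsIIDSample μ P fun i => y (m + i) where
  measurable _ := h.measurable _
  indep := h.indep.precomp (g := fun i => m + i) (add_right_injective m)
  map_eq _ := h.map_eq _

lemma measurePreserving (h : IsIIDSample μ P y) (i : ℕ) : MeasurePreserving (y i) μ P :=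
  ⟨h.measurable i, h.map_eq i⟩

lemma ae_all (h : IsIIDSample μ P y) {A : Y → Prop} (hA : ∀ᵐ x ∂P, A x) :
    ∀ᵐ ω ∂μ, ∀ i, A (y i ω) :=
  ae_all_iff.2 fun i => (h.measurePreserving i).quasiMeasurePreserving.ae hA

lemma measurePreserving_pi (h : IsIIDSample μ P y) {k : ℕ} {e : Fin k → ℕ}
    (he : Function.Injective e) :
    MeasurePreserving (fun ω i => y (e i) ω) μ (Measure.pi fun _ : Fin k => P) := by
  refine ⟨measurable_pi_iff.2 fun i => h.measurable _, ?_⟩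
  rw [(h.indep.precomp he).map_fun_eq_pi_map fun i => (h.measurable _).aemeasurable]
  simp [h.map_eq]

lemma indepFun_pi (h : IsIIDSample μ P y) {k : ℕ} {e e' : Fin k → ℕ}
    (hee : ∀ i j, e i ≠ e' j) :
    IndepFun (fun ω i => y (e i) ω) (fun ω i => y (e' i) ω) μ := by
  have hd : Disjoint (Finset.univ.image e) (Finset.univ.image e') := by
    rw [Finset.disjoint_left]
    intro a ha hb
    simp only [Finset.mem_image, Finset.mem_univ, true_and] at ha hb
    obtain ⟨i, rfl⟩ := ha
    obtain ⟨j, hj⟩ := hb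
    exact hee i j hj.symm
  have hi := h.indep.indepFun_finset _ _ hd h.measurable
  exact hi.comp
    (φ := fun (z : ↥(Finset.univ.image e : Finset ℕ) → Y) (i : Fin k) => z ⟨e i, by simp⟩)
    (ψ := fun (z : ↥(Finset.univ.image e' : Finset ℕ) → Y) (i : Fin k) => z ⟨e' i, by simp⟩)
    (measurable_pi_iff.2 fun i => measurable_pi_apply _)
    (measurable_pi_iff.2 fun i => measurable_pi_apply _)

lemma highProbability_sum_le (h : IsIIDSample μ P y) {φ : Y → ℝ} (hφ : Integrable φ P) {a : ℝ}
    (ha : ∫ x, φ x ∂P < a) :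
    HighProbability μ fun n ω => ∑ i ∈ Finset.range n, φ (y i ω) ≤ a * n := by
  have := h.indep.isProbabilityMeasure
  refine HighProbability.sum_le_of_integral_lt (X := fun i ω => φ (y i ω)) ?_ ?_ ?_ ?_
  · exact (h.measurePreserving 0).integrable_comp_of_integrable hφ
  · intro i j hij
    refine (h.indep.indepFun hij).comp₀ (h.measurable _).aemeasurable (h.measurable _).aemeasurable
      (φ := φ) (ψ := φ) ?_ ?_ <;> rw [h.map_eq] <;> exact hφ.aemeasurable
  · intro i
    have hid : IdentDistrib (y i) (y 0) μ μ :=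
      ⟨(h.measurable _).aemeasurable, (h.measurable _).aemeasurable, by rw [h.map_eq, h.map_eq]⟩
    refine hid.comp_of_aemeasurable (u := φ) ?_
    rw [h.map_eq]; exact hφ.aemeasurable
  · have := integral_map (h.measurable 0).aemeasurable (f := φ) (μ := μ)
      (by rw [h.map_eq]; exact hφ.aestronglyMeasurable)
    rw [h.map_eq] at this
    rwa [← this]

/-- The law of large numbers for consecutive blocks of length `k`, starting at time `m`. -/
lemma highProbability_sum_block_le (h : IsIIDSample μ P y) {k : ℕ} {φ : (Fin k → Y) → ℝ}
    (hφ : Integrable φ (Measure.pi fun _ : Fin k => P)) (m : ℕ) {a : ℝ}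
    (ha : ∫ x, φ x ∂(Measure.pi fun _ : Fin k => P) < a) :
    HighProbability μ fun n ω =>
      ∑ j ∈ Finset.range n, φ (fun i : Fin k => y (m + (k * j + i)) ω) ≤ a * n := by
  have := h.indep.isProbabilityMeasure
  have hmp : ∀ j, MeasurePreserving (fun ω (i : Fin k) => y (m + (k * j + i)) ω) μ
      (Measure.pi fun _ : Fin k => P) := fun j =>
    h.measurePreserving_pi (e := fun i : Fin k => m + (k * j + i)) fun i i' hii => by
      simpa [Fin.ext_iff] using hii
  refine HighProbability.sum_le_of_integral_lt
    (X := fun j ω => φ (fun i : Fin k => y (m + (k * j + i)) ω)) ?_ ?_ ?_ ?_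
  · exact (hmp 0).integrable_comp_of_integrable hφ
  · intro j j' hjj
    have hne : ∀ i i' : Fin k, m + (k * j + (i : ℕ)) ≠ m + (k * j' + (i' : ℕ)) := by
      intro i i' hc
      have hk : 0 < k := i.pos
      have h1 : (k * j + (i : ℕ)) / k = j := by
        rw [Nat.mul_add_div hk, Nat.div_eq_of_lt i.2, add_zero]
      have h2 : (k * j' + (i' : ℕ)) / k = j' := by
        rw [Nat.mul_add_div hk, Nat.div_eq_of_lt i'.2, add_zero]
      exact hjj (by rw [← h1, ← h2, Nat.add_left_cancel hc])
    refine (h.indepFun_pi hne).comp₀ (hmp j).measurable.aemeasurable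
      (hmp j').measurable.aemeasurable (φ := φ) (ψ := φ) ?_ ?_
    · rw [(hmp j).map_eq]; exact hφ.aemeasurable
    · rw [(hmp j').map_eq]; exact hφ.aemeasurable
  · intro j
    have hid : IdentDistrib (fun ω (i : Fin k) => y (m + (k * j + i)) ω)
        (fun ω (i : Fin k) => y (m + (k * 0 + i)) ω) μ μ :=
      ⟨(hmp j).measurable.aemeasurable, (hmp 0).measurable.aemeasurable,
        by rw [(hmp j).map_eq, (hmp 0).map_eq]⟩
    refine hid.comp_of_aemeasurable (u := φ) ?_
    rw [(hmp j).map_eq]; exact hφ.aemeasurable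
  · have := integral_map (hmp 0).measurable.aemeasurable (f := φ)
      (by rw [(hmp 0).map_eq]; exact hφ.aestronglyMeasurable)
    rw [(hmp 0).map_eq] at this
    rwa [← this]

end IsIIDSample

end Sample

/-! ### Linear decay of sums controlled only in blocks of `k`. -/

section Blocks

lemma sum_range_add_mod {s : ℕ} (x : ℕ → ℝ) (j : ℕ) :
    ∑ i ∈ Finset.range s, x ((i + j) % s) = ∑ i ∈ Finset.range s, x i := by
  induction j with
  | zero =>
    refine Finset.sum_congr rfl fun i hi => ?_
    rw [add_zero, Nat.mod_eq_of_lt (Finset.mem_range.1 hi)]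
  | succ j ih =>
    rw [← ih]
    have h1 := Finset.sum_range_succ (fun i => x ((i + j) % s)) s
    have h2 := Finset.sum_range_succ' (fun i => x ((i + j) % s)) s
    have h3 : x ((s + j) % s) = x ((0 + j) % s) := by simp
    have h4 : ∀ i, (i + (j + 1)) % s = (i + 1 + j) % s := fun i => by congr 1; ring
    simp only [h4]
    linarith

/-- Each of the `k` positions in the cyclic window runs over all residues once. A bound on sums over
`k` distinct observations thereby controls sums of any length `s ≥ k`, even when `k` does not divide
`s`. -/
lemma sum_range_windows {s k : ℕ} (x : ℕ → ℝ) :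
    ∑ i ∈ Finset.range s, ∑ j : Fin k, x ((i + j) % s) = k * ∑ i ∈ Finset.range s, x i := by
  rw [Finset.sum_comm]
  simp [sum_range_add_mod]

lemma sum_range_mul_blocks (k q : ℕ) (x : ℕ → ℝ) :
    ∑ i ∈ Finset.range (k * q), x i = ∑ j ∈ Finset.range q, ∑ i : Fin k, x (k * j + i) := by
  induction q with
  | zero => simp
  | succ q ih =>
    rw [Nat.mul_succ, Finset.sum_range_add, ih, Finset.sum_range_succ,
      Finset.sum_range (fun i => x (k * q + i))]

lemma window_injective {s k : ℕ} (hks : k ≤ s) (i : ℕ) :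
    Function.Injective fun j : Fin k => (i + j) % s := by
  intro j j' hjj
  have h : (j : ℕ) ≡ j' [MOD s] := Nat.ModEq.add_left_cancel' i hjj
  have := Nat.ModEq.eq_of_lt_of_lt h (j.2.trans_le hks) (j'.2.trans_le hks)
  exact Fin.ext this

variable {Ω Y ι : Type*} [MeasurableSpace Ω] [MeasurableSpace Y] {μ : Measure Ω} {P : Measure Y}
  {y : ℕ → Ω → Y}

/-- If the sums of a family of functions over `k` independent observations have a common upper
bound with negative mean, then the sums over `n` observations tend to `-∞` linearly in `n`,
uniformly over the family. -/
lemma IsIIDSample.highProbability_forall_sum_le_of_block (h : IsIIDSample μ P y) {k : ℕ}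
    (hk : 0 < k) {T : Set ι} {x : ι → Y → ℝ} {G : (Fin k → Y) → ℝ}
    (hG : Integrable G (Measure.pi fun _ : Fin k => P))
    (hneg : ∫ z, G z ∂(Measure.pi fun _ : Fin k => P) < 0)
    (hxG : ∀ᵐ z ∂(Measure.pi fun _ : Fin k => P), ∀ t ∈ T, ∑ i, x t (z i) ≤ G z) :
    ∃ c > 0, HighProbability μ fun n ω =>
      ∀ t ∈ T, ∑ i ∈ Finset.range n, x t (y i ω) ≤ -c * n := by
  have := h.indep.isProbabilityMeasure
  have hk' : (0 : ℝ) < k := by exact_mod_cast hk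
  obtain ⟨a, ha, hIa⟩ : ∃ a > 0, ∫ z, G z ∂(Measure.pi fun _ : Fin k => P) < -a :=
    ⟨-(∫ z, G z ∂(Measure.pi fun _ : Fin k => P)) / 2, by linarith, by linarith⟩
  -- The sample is cut into a head of length `k + n % k` and `n / k - 1` full blocks. The head has
  -- length at least `k` so that its cyclic windows consist of distinct observations; averaging `G`
  -- over them gives the bound `R`. Only `k` head lengths occur, so the head is negligible against
  -- `n`.
  set R : ℕ → Ω → ℝ := fun r ω =>
    (∑ i ∈ Finset.range (k + r), G fun j : Fin k => y ((i + j) % (k + r)) ω) / k with hR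
  have hwin : ∀ r i, MeasurePreserving (fun ω (j : Fin k) => y ((i + j) % (k + r)) ω) μ
      (Measure.pi fun _ : Fin k => P) := fun r i =>
    h.measurePreserving_pi (window_injective (Nat.le_add_right k r) i)
  have hblk : ∀ m j, MeasurePreserving (fun ω (i : Fin k) => y (m + (k * j + i)) ω) μ
      (Measure.pi fun _ : Fin k => P) := fun m j =>
    h.measurePreserving_pi (e := fun i : Fin k => m + (k * j + i)) fun i i' hii => by
      simpa [Fin.ext_iff] using hii
  have hRm : ∀ r, AEStronglyMeasurable (R r) μ := fun r =>
    ((integrable_finsetSum _ fun i _ =>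
      (hwin r i).integrable_comp_of_integrable hG).div_const _).aestronglyMeasurable
  have hRb : ∀ r, ∀ᵐ ω ∂μ, ∀ t ∈ T, ∑ i ∈ Finset.range (k + r), x t (y i ω) ≤ R r ω := by
    intro r
    have hall : ∀ᵐ ω ∂μ, ∀ i, ∀ t ∈ T, ∑ j : Fin k, x t (y ((i + j) % (k + r)) ω) ≤
        G fun j : Fin k => y ((i + j) % (k + r)) ω :=
      ae_all_iff.2 fun i => (hwin r i).quasiMeasurePreserving.ae hxG
    filter_upwards [hall] with ω hω t ht
    rw [hR, le_div_iff₀ hk', mul_comm, ← sum_range_windows]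
    exact Finset.sum_le_sum fun i _ => hω i t ht
  have hBb : ∀ᵐ ω ∂μ, ∀ m j, ∀ t ∈ T, ∑ i : Fin k, x t (y (m + (k * j + i)) ω) ≤
      G fun i : Fin k => y (m + (k * j + i)) ω :=
    ae_all_iff.2 fun m => ae_all_iff.2 fun j => (hblk m j).quasiMeasurePreserving.ae hxG
  have hq : Tendsto (fun n => n / k - 1) atTop atTop :=
    (tendsto_sub_atTop_nat 1).comp (Nat.tendsto_div_const_atTop hk.ne')
  have hW1 := HighProbability.forall_finset (Finset.range k) fun r _ =>
    (h.highProbability_sum_block_le hG (k + r) hIa).comp_tendsto hq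
  -- The blocks contribute at most `-a n / (2k)`; the head may spend half of that.
  have hW2 := HighProbability.forall_finset (Finset.range k) fun r _ =>
    HighProbability.le_mul_natCast (hRm r) (a := a / (4 * k)) (by positivity)
  refine ⟨a / (4 * k), by positivity, (hW1.and hW2).mono_ae ?_⟩
  filter_upwards [eventually_ge_atTop (4 * k)] with n hn
  filter_upwards [hBb, ae_all_iff.2 hRb] with ω hω1 hω2 hω t ht
  have hr : n % k < k := Nat.mod_lt _ hk
  have h1 := hω.1 (n % k) (Finset.mem_range.2 hr)
  have h2 := hω.2 (n % k) (Finset.mem_range.2 hr)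
  have hnk : 4 ≤ n / k := (Nat.le_div_iff_mul_le hk).2 hn
  have hn_eq : n = (k + n % k) + k * (n / k - 1) := by
    obtain ⟨q, hq⟩ : ∃ q, n / k = q + 1 := ⟨n / k - 1, by omega⟩
    have := Nat.div_add_mod n k
    rw [hq] at this ⊢
    rw [Nat.add_sub_cancel]
    linarith
  have hsum : ∑ i ∈ Finset.range n, x t (y i ω) =
      ∑ i ∈ Finset.range (k + n % k), x t (y i ω) +
      ∑ j ∈ Finset.range (n / k - 1), ∑ i : Fin k, x t (y ((k + n % k) + (k * j + i)) ω) := by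
    conv_lhs => rw [hn_eq]
    rw [Finset.sum_range_add, sum_range_mul_blocks]
  have h3 := hω2 (n % k) t ht
  have h4 : ∑ j ∈ Finset.range (n / k - 1), ∑ i : Fin k, x t (y ((k + n % k) + (k * j + i)) ω) ≤
      ∑ j ∈ Finset.range (n / k - 1), G fun i : Fin k => y ((k + n % k) + (k * j + i)) ω :=
    Finset.sum_le_sum fun j _ => hω1 _ _ t ht
  have h5 : (n : ℝ) / (2 * k) ≤ ((n / k - 1 : ℕ) : ℝ) := by
    rw [div_le_iff₀ (by positivity)]
    have : n ≤ (n / k - 1) * (2 * k) := by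
      have hlt := Nat.lt_div_mul_add (a := n) hk
      obtain ⟨q, hq⟩ : ∃ q, n / k = q + 4 := ⟨n / k - 4, by omega⟩
      rw [hq] at hlt ⊢
      have : q + 4 - 1 = q + 3 := by omega
      rw [this]
      nlinarith
    exact_mod_cast this
  have h6 : -a * ((n / k - 1 : ℕ) : ℝ) ≤ -a * ((n : ℝ) / (2 * k)) :=
    mul_le_mul_of_nonpos_left h5 (by linarith)
  have h7 : -a * ((n : ℝ) / (2 * k)) + a / (4 * k) * n = -(a / (4 * k)) * n := by
    field_simp; ring
  rw [hsum]
  linarith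

end Blocks

/-! ### Integrable envelopes for families of functions. -/

section Envelope

variable {X Y : Type*} [TopologicalSpace X] [SecondCountableTopology X] [MeasurableSpace Y]
  {P : Measure Y}

/-- If the suprema of `F · y` over a decreasing sequence of sets `D j` are bounded by an integrable
function and their limit superior by `b`, then on some `D j` the functions `F x` have an integrable
common upper bound whose integral is nearly that of `b`. -/
lemma exists_integrable_envelope {D : ℕ → Set X} (hD : Antitone D) {F : X → Y → ℝ}
    (hFm : ∀ x ∈ D 0, AEMeasurable (F x) P)
    (hFc : ∀ᵐ y ∂P, ContinuousOn (fun x => F x y) (D 0)) {G b : Y → ℝ}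
    (hG : Integrable G P) (hb : Integrable b P)
    (hFG : ∀ᵐ y ∂P, ∀ x ∈ D 0, F x y ≤ G y)
    (hlim : ∀ᵐ y ∂P, ∀ ε > 0, ∃ j, ∀ x ∈ D j, F x y ≤ b y + ε)
    {a : ℝ} (ha : ∫ y, b y ∂P < a) :
    ∃ j, ∃ φ : Y → ℝ, Integrable φ P ∧ ∫ y, φ y ∂P < a ∧ ∀ᵐ y ∂P, ∀ x ∈ D j, F x y ≤ φ y := by
  choose C hCc hCd using fun j => TopologicalSpace.exists_countable_dense (D j)
  -- A countable dense subset makes the supremum measurable, and continuity extends the bound to all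
  -- of `D j`. The extra index `none` puts `b` among the competitors: this keeps the index set
  -- nonempty, bounds `φ j` below by an integrable function, and gives the lower half of the
  -- convergence to `b`.
  set φ : ℕ → Y → ℝ := fun j y => ⨆ o : Option (C j), o.elim (b y) (fun x => F x.1 y) with hφ
  have hcount : ∀ j, Countable (C j) := fun j => (hCc j).to_subtype
  have hsub : ∀ j (x : D j), x.1 ∈ D 0 := fun j x => hD (zero_le : 0 ≤ j) x.2
  have hmeas : ∀ j, AEMeasurable (φ j) P := by
    intro j
    refine AEMeasurable.iSup fun o => ?_
    cases o with
    | none => exact hb.aemeasurable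
    | some x => exact hFm _ (hsub j x.1)
  have hbdd : ∀ᵐ y ∂P, ∀ j, BddAbove (Set.range fun o : Option (C j) =>
      o.elim (b y) (fun x => F x.1 y)) := by
    filter_upwards [hFG] with y hy j
    refine ⟨max (b y) (G y), ?_⟩
    rintro _ ⟨o, rfl⟩
    cases o with
    | none => exact le_max_left _ _
    | some x => exact (hy _ (hsub j x.1)).trans (le_max_right _ _)
  have hbφ : ∀ᵐ y ∂P, ∀ j, b y ≤ φ j y := by
    filter_upwards [hbdd] with y hy j
    exact le_ciSup (hy j) none
  have hFφ : ∀ᵐ y ∂P, ∀ j, ∀ x ∈ D j, F x y ≤ φ j y := by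
    filter_upwards [hbdd, hFc] with y hy hc j x hx
    have hcont : Continuous fun x : D j => F x.1 y :=
      continuousOn_iff_continuous_domRestrict.1 (hc.mono (hD (zero_le : 0 ≤ j)))
    have hcl : IsClosed {x : D j | F x.1 y ≤ φ j y} := isClosed_le hcont continuous_const
    have hsubset : C j ⊆ {x : D j | F x.1 y ≤ φ j y} := fun x hx => le_ciSup (hy j) (some ⟨x, hx⟩)
    have := hcl.closure_subset_iff.2 hsubset
    rw [(hCd j).closure_eq] at this
    exact this (Set.mem_univ (⟨x, hx⟩ : D j))
  have hφle : ∀ᵐ y ∂P, ∀ j, φ j y ≤ max (b y) (G y) := by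
    filter_upwards [hFG] with y hy j
    refine ciSup_le fun o => ?_
    cases o with
    | none => exact le_max_left _ _
    | some x => exact (hy _ (hsub j x.1)).trans (le_max_right _ _)
  have habs : ∀ j, ∀ᵐ y ∂P, ‖φ j y‖ ≤ |b y| + |G y| := by
    intro j
    filter_upwards [hbφ, hφle] with y h1 h2
    have h1 := h1 j
    have h2 := h2 j
    rw [Real.norm_eq_abs, abs_le]
    constructor
    · linarith [neg_abs_le (b y), abs_nonneg (G y)]
    · exact h2.trans (max_le (by linarith [le_abs_self (b y), abs_nonneg (G y)])
        (by linarith [le_abs_self (G y), abs_nonneg (b y)]))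
  have hconv : ∀ᵐ y ∂P, Tendsto (fun j => φ j y) atTop (𝓝 (b y)) := by
    filter_upwards [hbφ, hlim] with y h1 h2
    rw [Metric.tendsto_atTop]
    intro ε hε
    obtain ⟨j₀, hj₀⟩ := h2 (ε / 2) (by positivity)
    refine ⟨j₀, fun j hj => ?_⟩
    have hle : φ j y ≤ b y + ε / 2 := by
      refine ciSup_le fun o => ?_
      cases o with
      | none => change b y ≤ _; linarith
      | some x => exact hj₀ _ (hD hj x.1.2)
    rw [Real.dist_eq, abs_lt]
    constructor <;> linarith [h1 j]
  have hbound : Integrable (fun y => |b y| + |G y|) P := hb.abs.add hG.abs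
  have hT := tendsto_integral_of_dominated_convergence _ (fun j => (hmeas j).aestronglyMeasurable)
    hbound habs hconv
  obtain ⟨j, hj⟩ := ((tendsto_order.1 hT).2 a ha).exists
  refine ⟨j, φ j, hbound.mono' (hmeas j).aestronglyMeasurable (habs j), hj, ?_⟩
  filter_upwards [hFφ] with y hy
  exact hy j

end Envelope

/-! ### Second-order Taylor estimates. -/

section Taylor

variable {E : Type*} [NormedAddCommGroup E] [NormedSpace ℝ E] {f : E → ℝ} {x : E} {r : ℝ}

lemma abs_sub_fderiv_le_of_norm_fderiv_fderiv_le (hf : ContDiffOn ℝ 2 f (Metric.ball x r)) {H : ℝ}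
    (hH : ∀ z ∈ Metric.ball x r, ‖fderiv ℝ (fderiv ℝ f) z‖ ≤ H) {h : E} (hh : ‖h‖ < r) :
    |f (x + h) - f x - fderiv ℝ f x h| ≤ H * ‖h‖ ^ 2 := by
  have hr : 0 < r := (norm_nonneg h).trans_lt hh
  have hopen : IsOpen (Metric.ball x r) := Metric.isOpen_ball
  have hH0 : 0 ≤ H := (norm_nonneg (fderiv ℝ (fderiv ℝ f) x)).trans (hH x (Metric.mem_ball_self hr))
  have hd1 : ∀ z ∈ Metric.ball x r, DifferentiableAt ℝ f z := fun z hz =>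
    ((hf z hz).contDiffAt (hopen.mem_nhds hz)).differentiableAt (by norm_num)
  have hd2 : ∀ z ∈ Metric.ball x r, DifferentiableAt ℝ (fderiv ℝ f) z := fun z hz =>
    (((hf z hz).contDiffAt (hopen.mem_nhds hz)).fderiv_right (m := 1) (by norm_num)).differentiableAt
      (by norm_num)
  have hlip : ∀ z ∈ Metric.ball x r, ‖fderiv ℝ f z - fderiv ℝ f x‖ ≤ H * ‖z - x‖ := fun z hz =>
    (convex_ball x r).norm_image_sub_le_of_norm_fderiv_le hd2 hH (Metric.mem_ball_self hr) hz
  have hseg : segment ℝ x (x + h) ⊆ Metric.ball x r :=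
    (convex_ball x r).segment_subset (Metric.mem_ball_self hr) (by simpa using hh)
  have hsegn : ∀ z ∈ segment ℝ x (x + h), ‖z - x‖ ≤ ‖h‖ := by
    intro z hz
    have := norm_sub_le_of_mem_segment hz
    simpa using this
  have := (convex_segment x (x + h)).norm_image_sub_le_of_norm_fderiv_le' (f := f)
    (φ := fderiv ℝ f x) (C := H * ‖h‖) (fun z hz => hd1 z (hseg hz))
    (fun z hz => (hlip z (hseg hz)).trans (by gcongr; exact hsegn z hz))
    (left_mem_segment ℝ x (x + h)) (right_mem_segment ℝ x (x + h))
  simp only [add_sub_cancel_left, Real.norm_eq_abs] at this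
  rw [pow_two, ← mul_assoc]
  exact this

/-- The mean value inequality on the segment is applied to `f` minus its quadratic Taylor
polynomial, whose derivative is small because `fderiv ℝ f` is differentiable at `x`. Symmetry of the
second derivative identifies the derivative of the quadratic term. -/
lemma exists_abs_sub_fderiv_sub_le (hr : 0 < r) (hf : ContDiffOn ℝ 2 f (Metric.ball x r)) {ε : ℝ}
    (hε : 0 < ε) :
    ∃ δ > 0, ∀ h : E, ‖h‖ < δ →
      |f (x + h) - f x - fderiv ℝ f x h - fderiv ℝ (fderiv ℝ f) x h h / 2| ≤ ε * ‖h‖ ^ 2 := by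
  have hopen : IsOpen (Metric.ball x r) := Metric.isOpen_ball
  have hx : x ∈ Metric.ball x r := Metric.mem_ball_self hr
  have hcx : ContDiffAt ℝ 2 f x := (hf x hx).contDiffAt (hopen.mem_nhds hx)
  have hd1 : ∀ z ∈ Metric.ball x r, DifferentiableAt ℝ f z := fun z hz =>
    ((hf z hz).contDiffAt (hopen.mem_nhds hz)).differentiableAt (by norm_num)
  have hd2 : DifferentiableAt ℝ (fderiv ℝ f) x :=
    (hcx.fderiv_right (m := 1) (by norm_num)).differentiableAt (by norm_num)
  set Q := fderiv ℝ (fderiv ℝ f) x with hQ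
  have hsymm : ∀ v w, Q v w = Q w v := fun v w => hcx.isSymmSndFDerivAt (by simp) v w
  have ho := hd2.hasFDerivAt.isLittleO.def hε
  obtain ⟨δ, hδ, hball⟩ := Metric.eventually_nhds_iff_ball.1 ho
  refine ⟨min δ r, lt_min hδ hr, fun h hh => ?_⟩
  have hseg : segment ℝ x (x + h) ⊆ Metric.ball x (min δ r) :=
    (convex_ball x _).segment_subset (Metric.mem_ball_self (lt_min hδ hr)) (by simpa using hh)
  have hsegn : ∀ z ∈ segment ℝ x (x + h), ‖z - x‖ ≤ ‖h‖ := by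
    intro z hz
    have := norm_sub_le_of_mem_segment hz
    simpa using this
  have hder : ∀ z ∈ segment ℝ x (x + h), HasFDerivWithinAt
      (fun z => f z - fderiv ℝ f x (z - x) - Q (z - x) (z - x) / 2)
      (fderiv ℝ f z - fderiv ℝ f x - Q (z - x)) (segment ℝ x (x + h)) z := by
    intro z hz
    refine HasFDerivAt.hasFDerivWithinAt ?_
    have h1 := (hd1 z (Metric.ball_subset_ball (min_le_right _ _) (hseg hz))).hasFDerivAt
    have hid : HasFDerivAt (fun z : E => z - x) (ContinuousLinearMap.id ℝ E) z :=
      (hasFDerivAt_id z).sub_const x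
    have h2 : HasFDerivAt (fun z => fderiv ℝ f x (z - x)) (fderiv ℝ f x) z := by
      exact (fderiv ℝ f x).hasFDerivAt.comp z hid
    have h3 : HasFDerivAt (fun z => Q (z - x)) Q z := by
      exact Q.hasFDerivAt.comp z hid
    have h4 := (h3.clm_apply hid).const_mul (1 / 2 : ℝ)
    have h5 := (h1.sub h2).sub h4
    refine (h5.congr_fderiv ?_).congr_of_eventuallyEq (Eventually.of_forall fun w => ?_)
    · ext v
      simp [hsymm v z, hsymm v x]
      ring
    · simp
      ring
  have hb : ∀ z ∈ segment ℝ x (x + h), ‖fderiv ℝ f z - fderiv ℝ f x - Q (z - x)‖ ≤ ε * ‖h‖ := by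
    intro z hz
    refine (hball z (Metric.ball_subset_ball (min_le_left _ _) (hseg hz))).trans ?_
    gcongr
    exact hsegn z hz
  have := (convex_segment x (x + h)).norm_image_sub_le_of_norm_hasFDerivWithin_le hder hb
    (left_mem_segment ℝ x (x + h)) (right_mem_segment ℝ x (x + h))
  simp only [add_sub_cancel_left, Real.norm_eq_abs, sub_self, map_zero] at this
  rw [pow_two, ← mul_assoc]
  convert this using 2
  simp
  ring

end Taylor

/-! ### Consequences of exponential moments bounded by one. -/

section ExponentialMoments

variable {Y : Type*} [MeasurableSpace Y] {P : Measure Y}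

lemma integrable_of_lintegral_ofReal_le_one {f : Y → ℝ} (hf : AEMeasurable f P) (h0 : 0 ≤ᵐ[P] f)
    (h : ∫⁻ y, ENNReal.ofReal (f y) ∂P ≤ 1) : Integrable f P ∧ ∫ y, f y ∂P ≤ 1 := by
  have hi : Integrable f P := by
    refine ⟨hf.aestronglyMeasurable, ?_⟩
    rw [hasFiniteIntegral_iff_ofReal h0]
    exact h.trans_lt ENNReal.one_lt_top
  refine ⟨hi, ?_⟩
  rw [integral_eq_lintegral_of_nonneg_ae h0 hf.aestronglyMeasurable]
  exact ENNReal.toReal_le_of_le_ofReal zero_le_one (by simpa using h)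

/-- If `𝔼[exp X] ≤ 1` and `X` is not almost surely zero, then `X` has negative mean, even after
truncation from below. -/
lemma exists_integral_max_neg [IsProbabilityMeasure P] {X G : Y → ℝ} (hX : AEMeasurable X P)
    (hG : Integrable G P) (hXG : X ≤ᵐ[P] G) (hexp : ∫⁻ y, ENNReal.ofReal (Real.exp (X y)) ∂P ≤ 1)
    (hne : ¬ X =ᵐ[P] 0) :
    ∃ A : ℝ, Integrable (fun y => max (X y) (-A)) P ∧ ∫ y, max (X y) (-A) ∂P < 0 := by
  obtain ⟨hEi, hE⟩ := integrable_of_lintegral_ofReal_le_one (f := fun y => Real.exp (X y))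
    (Real.measurable_exp.comp_aemeasurable hX) (ae_of_all _ fun y => (Real.exp_pos _).le) hexp
  -- The defect in `X ≤ exp X - 1` vanishes only where `X = 0`. Capping it at `1` makes it
  -- integrable even when `X` is not, and leaves its mean `d` positive.
  set ψ : Y → ℝ := fun y => min (Real.exp (X y) - 1 - X y) 1 with hψ
  have hψ0 : ∀ y, 0 ≤ ψ y := fun y =>
    le_min (by linarith [Real.add_one_le_exp (X y)]) zero_le_one
  have hψi : Integrable ψ P := by
    refine (integrable_const (1 : ℝ)).mono' ?_ (ae_of_all _ fun y => ?_)
    · exact ((((Real.measurable_exp.comp_aemeasurable hX).sub_const 1).sub hX).min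
        aemeasurable_const).aestronglyMeasurable
    · rw [Real.norm_eq_abs, abs_of_nonneg (hψ0 y)]
      exact min_le_right _ _
  have hd : 0 < ∫ y, ψ y ∂P := by
    refine lt_of_le_of_ne (integral_nonneg hψ0) fun h => hne ?_
    have h0 := (integral_eq_zero_iff_of_nonneg hψ0 hψi).1 h.symm
    filter_upwards [h0] with y hy
    by_contra hXy
    have h1 : 0 < Real.exp (X y) - 1 - X y := by linarith [Real.add_one_lt_exp hXy]
    have h2 : 0 < ψ y := lt_min h1 zero_lt_one
    exact h2.ne' hy
  set d := ∫ y, ψ y ∂P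
  -- `2 ≤ A` makes the pointwise bound below hold on the truncated branch, where its right side
  -- exceeds `-2`; `exp (-A) < d` makes the integrated bound `exp (-A) - d` negative.
  obtain ⟨A, hA2, hAd⟩ : ∃ A : ℝ, 2 ≤ A ∧ Real.exp (-A) < d := by
    have ht : Tendsto (fun A : ℝ => Real.exp (-A)) atTop (𝓝 0) :=
      Real.tendsto_exp_neg_atTop_nhds_zero
    exact ((eventually_ge_atTop 2).and ((tendsto_order.1 ht).2 d hd)).exists
  have hZi : Integrable (fun y => max (X y) (-A)) P := by
    refine (hG.abs.add (integrable_const |A|)).mono' (hX.max aemeasurable_const).aestronglyMeasurable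
      ?_
    filter_upwards [hXG] with y hy
    rw [Real.norm_eq_abs, abs_le, Pi.add_apply]
    constructor
    · linarith [le_max_right (X y) (-A), le_abs_self A, abs_nonneg (G y)]
    · exact max_le (by linarith [le_abs_self (G y), abs_nonneg A])
        (by linarith [neg_le_abs A, abs_nonneg (G y)])
  refine ⟨A, hZi, ?_⟩
  have hle : ∀ y, max (X y) (-A) ≤ Real.exp (X y) + Real.exp (-A) - 1 - ψ y := by
    intro y
    have h1 : ψ y ≤ Real.exp (X y) - 1 - X y := min_le_left _ _
    have h2 : ψ y ≤ 1 := min_le_right _ _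
    have h3 := Real.exp_pos (X y)
    have h4 := Real.exp_pos (-A)
    exact max_le (by linarith) (by linarith)
  have hint : Integrable (fun y => Real.exp (X y) + Real.exp (-A) - 1 - ψ y) P :=
    ((hEi.add (integrable_const _)).sub (integrable_const _)).sub hψi
  have := integral_mono hZi hint hle
  have hi1 : Integrable (fun y => Real.exp (X y) + Real.exp (-A)) P :=
    hEi.add (integrable_const _)
  have hi2 : Integrable (fun y => Real.exp (X y) + Real.exp (-A) - 1) P :=
    hi1.sub (integrable_const _)
  rw [integral_sub hi2 hψi, integral_sub hi1 (integrable_const _),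
    integral_add hEi (integrable_const _)] at this
  simp only [integral_const, probReal_univ, one_smul] at this
  change _ ≤ _ - d at this
  linarith

lemma two_add_sq_le_exp_add_exp_neg (x : ℝ) : 2 + x ^ 2 ≤ Real.exp x + Real.exp (-x) := by
  have h1 : Real.exp x + Real.exp (-x) = 2 + 4 * Real.sinh (x / 2) ^ 2 := by
    rw [Real.sinh_eq]
    have e1 : Real.exp x = Real.exp (x / 2) ^ 2 := by rw [← Real.exp_nat_mul]; congr 1; push_cast; ring
    have e2 : Real.exp (-x) = Real.exp (-(x / 2)) ^ 2 := by
      rw [← Real.exp_nat_mul]; congr 1; push_cast; ring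
    have e3 : Real.exp (x / 2) * Real.exp (-(x / 2)) = 1 := by rw [← Real.exp_add]; simp
    rw [e1, e2]
    linear_combination 2 * e3
  have h2 : (x / 2) ^ 2 ≤ Real.sinh (x / 2) ^ 2 := by
    rw [sq_le_sq]
    rcases le_total 0 (x / 2) with h | h
    · rw [abs_of_nonneg h, abs_of_nonneg (Real.sinh_nonneg_iff.2 h)]
      exact Real.self_le_sinh_iff.2 h
    · rw [abs_of_nonpos h, abs_of_nonpos (Real.sinh_nonpos_iff.2 h)]
      linarith [Real.sinh_le_self_iff.2 h]
  rw [h1]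
  linarith

/-- If `𝔼[exp (t s - H t ^ 2)] ≤ 1` for all small `t`, then `s` is centred and square integrable. -/
lemma memLp_two_and_integral_eq_zero_of_exp [IsProbabilityMeasure P] {s H : Y → ℝ} {t₀ : ℝ}
    (ht₀ : 0 < t₀) (hs : AEMeasurable s P) (hH : Integrable H P)
    (hexp : ∀ t, |t| < t₀ → ∫⁻ y, ENNReal.ofReal (Real.exp (t * s y - H y * t ^ 2)) ∂P ≤ 1) :
    MemLp s 2 P ∧ ∫ y, s y ∂P = 0 := by
  have hmeas : ∀ t : ℝ, AEMeasurable (fun y => Real.exp (t * s y - H y * t ^ 2)) P := fun t =>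
    Real.measurable_exp.comp_aemeasurable ((hs.const_mul t).sub (hH.aemeasurable.mul_const _))
  have hE : ∀ t, |t| < t₀ → Integrable (fun y => Real.exp (t * s y - H y * t ^ 2)) P ∧
      ∫ y, Real.exp (t * s y - H y * t ^ 2) ∂P ≤ 1 := fun t ht =>
    integrable_of_lintegral_ofReal_le_one (hmeas t) (ae_of_all _ fun y => (Real.exp_pos _).le)
      (hexp t ht)
  have hbound : ∀ t, t ≠ 0 → |t| < t₀ →
      ∫⁻ y, ENNReal.ofReal (s y ^ 2 * Real.exp (-(H y * t ^ 2))) ∂P ≤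
        ENNReal.ofReal (2 * ∫ y, H y ∂P) := by
    intro t ht0 ht
    obtain ⟨hi1, hb1⟩ := hE t ht
    obtain ⟨hi2, hb2⟩ := hE (-t) (by rwa [abs_neg])
    -- Adding the hypotheses at `t` and `-t` cancels the linear term. With `2 + x² ≤ exp x + exp
    -- (-x)` and `exp (-x) ≥ 1 - x`, this leaves a bound on a damped second moment that is uniform
    -- in `t`.
    set g : Y → ℝ := fun y => (Real.exp (t * s y - H y * t ^ 2) +
      Real.exp (-t * s y - H y * (-t) ^ 2) - 2 + H y * (2 * t ^ 2)) / t ^ 2 with hg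
    have ht2 : 0 < t ^ 2 := by positivity
    have hle : ∀ y, s y ^ 2 * Real.exp (-(H y * t ^ 2)) ≤ g y := by
      intro y
      rw [hg, le_div_iff₀ ht2]
      have e1 : Real.exp (t * s y - H y * t ^ 2) =
          Real.exp (t * s y) * Real.exp (-(H y * t ^ 2)) := by rw [← Real.exp_add]; ring_nf
      have e2 : Real.exp (-t * s y - H y * (-t) ^ 2) =
          Real.exp (-(t * s y)) * Real.exp (-(H y * t ^ 2)) := by rw [← Real.exp_add]; ring_nf
      have h3 := two_add_sq_le_exp_add_exp_neg (t * s y)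
      have h4 := Real.add_one_le_exp (-(H y * t ^ 2))
      have h5 := mul_le_mul_of_nonneg_right h3 (Real.exp_pos (-(H y * t ^ 2))).le
      rw [e1, e2]
      linarith
    have hi12 : Integrable (fun y => Real.exp (t * s y - H y * t ^ 2) +
        Real.exp (-t * s y - H y * (-t) ^ 2)) P := hi1.add hi2
    have hi3 : Integrable (fun y => Real.exp (t * s y - H y * t ^ 2) +
        Real.exp (-t * s y - H y * (-t) ^ 2) - 2) P := hi12.sub (integrable_const 2)
    have hgi : Integrable g P := (hi3.add (hH.mul_const _)).div_const _
    have hgI : ∫ y, g y ∂P ≤ 2 * ∫ y, H y ∂P := by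
      rw [hg, integral_div, integral_add hi3 (hH.mul_const _),
        integral_sub hi12 (integrable_const 2), integral_add hi1 hi2, integral_mul_const,
        div_le_iff₀ ht2]
      simp only [integral_const, probReal_univ, one_smul]
      linarith
    calc ∫⁻ y, ENNReal.ofReal (s y ^ 2 * Real.exp (-(H y * t ^ 2))) ∂P
        ≤ ∫⁻ y, ENNReal.ofReal (g y) ∂P :=
          lintegral_mono fun y => ENNReal.ofReal_le_ofReal (hle y)
      _ = ENNReal.ofReal (∫ y, g y ∂P) := (ofReal_integral_eq_lintegral_ofReal hgi
          (ae_of_all _ fun y => le_trans (by positivity) (hle y))).symm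
      _ ≤ _ := ENNReal.ofReal_le_ofReal hgI
  -- The shift by `2` keeps every term strictly below `t₀`, including `j = 0`.
  have htj : ∀ j : ℕ, 0 < t₀ / (j + 2) ∧ t₀ / (j + 2) < t₀ := fun j => by
    refine ⟨by positivity, ?_⟩
    rw [div_lt_iff₀ (by positivity)]
    nlinarith [(Nat.cast_nonneg j : (0 : ℝ) ≤ j)]
  have htlim : Tendsto (fun j : ℕ => t₀ / ((j : ℝ) + 2)) atTop (𝓝 0) :=
    tendsto_const_nhds.div_atTop (tendsto_atTop_add_const_right _ _ tendsto_natCast_atTop_atTop)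
  -- Fatou's lemma removes the damping factor as `t → 0`.
  have hL2 : ∫⁻ y, ENNReal.ofReal (s y ^ 2) ∂P ≤ ENNReal.ofReal (2 * ∫ y, H y ∂P) := by
    have hlim : ∀ y, liminf (fun j : ℕ => ENNReal.ofReal
        (s y ^ 2 * Real.exp (-(H y * (t₀ / ((j : ℝ) + 2)) ^ 2)))) atTop =
        ENNReal.ofReal (s y ^ 2) := by
      intro y
      refine Tendsto.liminf_eq (ENNReal.tendsto_ofReal ?_)
      have h1 : Tendsto (fun j : ℕ => -(H y * (t₀ / ((j : ℝ) + 2)) ^ 2)) atTop (𝓝 0) := by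
        simpa using ((htlim.pow 2).const_mul (H y)).neg
      have h2 := (Real.continuous_exp.tendsto _).comp h1
      simpa using h2.const_mul (s y ^ 2)
    calc ∫⁻ y, ENNReal.ofReal (s y ^ 2) ∂P
        = ∫⁻ y, liminf (fun j : ℕ => ENNReal.ofReal
          (s y ^ 2 * Real.exp (-(H y * (t₀ / ((j : ℝ) + 2)) ^ 2)))) atTop ∂P := by simp_rw [hlim]
      _ ≤ liminf (fun j : ℕ => ∫⁻ y, ENNReal.ofReal
          (s y ^ 2 * Real.exp (-(H y * (t₀ / ((j : ℝ) + 2)) ^ 2))) ∂P) atTop := by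
          refine lintegral_liminf_le' fun j => AEMeasurable.ennreal_ofReal ?_
          exact (hs.pow_const 2).mul
            (Real.measurable_exp.comp_aemeasurable (hH.aemeasurable.mul_const _).neg)
      _ ≤ liminf (fun _ : ℕ => ENNReal.ofReal (2 * ∫ y, H y ∂P)) atTop := by
          refine liminf_le_liminf (Eventually.of_forall fun j => ?_)
          exact hbound _ (htj j).1.ne' (by rw [abs_of_pos (htj j).1]; exact (htj j).2)
      _ = _ := liminf_const _
  have hmem : MemLp s 2 P := by
    rw [memLp_two_iff_integrable_sq hs.aestronglyMeasurable]
    refine ⟨(hs.pow_const 2).aestronglyMeasurable, ?_⟩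
    rw [hasFiniteIntegral_iff_ofReal (ae_of_all _ fun y => sq_nonneg (s y))]
    exact hL2.trans_lt ENNReal.ofReal_lt_top
  refine ⟨hmem, ?_⟩
  have hsi : Integrable s P := hmem.integrable one_le_two
  -- The inequality `1 + x ≤ exp x` gives a linear term dominated by a quadratic one; dividing by
  -- small `t` of either sign forces the mean to vanish.
  have hmean : ∀ t, |t| < t₀ → t * ∫ y, s y ∂P ≤ (∫ y, H y ∂P) * t ^ 2 := by
    intro t ht
    obtain ⟨hi, hb⟩ := hE t ht
    have hi₀ : Integrable (fun y => t * s y - H y * t ^ 2) P :=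
      (hsi.const_mul t).sub (hH.mul_const _)
    have hi' : Integrable (fun y => t * s y - H y * t ^ 2 + 1) P := hi₀.add (integrable_const 1)
    have := integral_mono hi' hi fun y => Real.add_one_le_exp _
    rw [integral_add hi₀ (integrable_const 1),
      integral_sub (hsi.const_mul t) (hH.mul_const _), integral_const_mul, integral_mul_const] at this
    simp only [integral_const, probReal_univ, one_smul] at this
    linarith
  have hlim0 : Tendsto (fun j : ℕ => (∫ y, H y ∂P) * (t₀ / ((j : ℝ) + 2))) atTop (𝓝 0) := by
    simpa using htlim.const_mul (∫ y, H y ∂P)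
  refine le_antisymm (ge_of_tendsto' hlim0 fun j => ?_) ?_
  · have := hmean _ (by rw [abs_of_pos (htj j).1]; exact (htj j).2)
    nlinarith [(htj j).1]
  · rw [← neg_nonpos]
    refine ge_of_tendsto' hlim0 fun j => ?_
    have := hmean (-(t₀ / ((j : ℝ) + 2))) (by rw [abs_neg, abs_of_pos (htj j).1]; exact (htj j).2)
    nlinarith [(htj j).1]

end ExponentialMoments

/-! ### Likelihood ratio, score and Hessian of one observation. -/

namespace BayesModel

variable {Y : Type*} [MeasurableSpace Y] {p : ℕ} (M : BayesModel Y p)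

/-- The log-likelihood ratio of one observation against the parameter `θ₀`. -/
noncomputable def logRatio (θ₀ θ : EuclideanSpace ℝ (Fin p)) (y : Y) : ℝ :=
  M.logDensity y θ - M.logDensity y θ₀

/-- The derivative of the log-likelihood of one observation at `θ₀`. -/
noncomputable def score (θ₀ : EuclideanSpace ℝ (Fin p)) (y : Y) : EuclideanSpace ℝ (Fin p) →L[ℝ] ℝ :=
  fderiv ℝ (M.logDensity y) θ₀

variable {M} {θ₀ θ : EuclideanSpace ℝ (Fin p)}

lemma isProbabilityMeasure_law (hθ : θ ∈ M.params) : IsProbabilityMeasure (M.law θ) :=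
  ⟨by rw [law, withDensity_apply _ MeasurableSet.univ, Measure.restrict_univ,
    M.lintegral_density θ hθ]⟩

lemma measurable_logRatio (h₀ : θ₀ ∈ M.params) (hθ : θ ∈ M.params) :
    Measurable (M.logRatio θ₀ θ) :=
  (Real.measurable_log.comp (M.measurable_density θ hθ)).sub
    (Real.measurable_log.comp (M.measurable_density θ₀ h₀))

/-- The integral is the mass of the density at `θ` where the density at `θ₀` is nonzero. It can be
less than `1`, since positivity is known only almost everywhere for the law at `θ₀`. -/
lemma lintegral_exp_logRatio_le_one (h₀ : θ₀ ∈ M.params)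
    (hpos : ∀ᵐ y ∂(M.law θ₀), ∀ θ ∈ M.params, 0 < M.density θ y) (hθ : θ ∈ M.params) :
    ∫⁻ y, ENNReal.ofReal (Real.exp (M.logRatio θ₀ θ y)) ∂(M.law θ₀) ≤ 1 := by
  have hae : ∀ᵐ y ∂(M.law θ₀), ENNReal.ofReal (Real.exp (M.logRatio θ₀ θ y)) =
      ENNReal.ofReal (M.density θ y / M.density θ₀ y) := by
    filter_upwards [hpos] with y hy
    rw [logRatio, logDensity, logDensity, Real.exp_sub, Real.exp_log (hy θ hθ),
      Real.exp_log (hy θ₀ h₀)]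
  have hm : Measurable fun y => ENNReal.ofReal (M.density θ y / M.density θ₀ y) :=
    ((M.measurable_density θ hθ).div (M.measurable_density θ₀ h₀)).ennreal_ofReal
  rw [lintegral_congr_ae hae, law, lintegral_withDensity_eq_lintegral_mul _
    (M.measurable_density θ₀ h₀).ennreal_ofReal hm, ← M.lintegral_density θ hθ]
  refine lintegral_mono fun y => ?_
  rw [Pi.mul_apply, ← ENNReal.ofReal_mul (M.density_nonneg θ₀ h₀ y)]
  refine ENNReal.ofReal_le_ofReal ?_
  rcases eq_or_ne (M.density θ₀ y) 0 with h | h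
  · rw [h, zero_mul]
    exact M.density_nonneg θ hθ y
  · rw [mul_div_cancel₀ _ h]

/-- The densities agree where the one at `θ₀` is positive, so it is dominated by the other almost
everywhere. Having the same total mass, they are equal also on its zero set. -/
lemma law_eq_of_logRatio_ae_eq_zero (h₀ : θ₀ ∈ M.params)
    (hpos : ∀ᵐ y ∂(M.law θ₀), ∀ θ ∈ M.params, 0 < M.density θ y) (hθ : θ ∈ M.params)
    (h : M.logRatio θ₀ θ =ᵐ[M.law θ₀] 0) : M.law θ = M.law θ₀ := by
  have hae : ∀ᵐ y ∂(M.law θ₀), M.density θ y = M.density θ₀ y := by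
    filter_upwards [hpos, h] with y hy hz
    exact Real.log_injOn_pos (hy θ hθ) (hy θ₀ h₀) (sub_eq_zero.1 hz)
  rw [law, ae_withDensity_iff (M.measurable_density θ₀ h₀).ennreal_ofReal] at hae
  have hle : (fun y => ENNReal.ofReal (M.density θ₀ y)) ≤ᵐ[M.ref]
      fun y => ENNReal.ofReal (M.density θ y) := by
    filter_upwards [hae] with y hy
    rcases eq_or_ne (ENNReal.ofReal (M.density θ₀ y)) 0 with h | h
    · rw [h]; exact zero_le
    · rw [hy h]
  have heq := ae_eq_of_ae_le_of_lintegral_le hle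
    (by rw [M.lintegral_density θ₀ h₀]; exact ENNReal.one_ne_top)
    (M.measurable_density θ hθ).ennreal_ofReal.aemeasurable
    (by rw [M.lintegral_density θ hθ, M.lintegral_density θ₀ h₀])
  exact (withDensity_congr_ae heq).symm

variable {r : ℝ} {H : Y → ℝ}

lemma ae_abs_logRatio_sub_score_le
    (hsm : ∀ᵐ y ∂(M.law θ₀), ContDiffOn ℝ 2 (M.logDensity y) (Metric.ball θ₀ r) ∧
      ∀ θ ∈ Metric.ball θ₀ r, ‖M.hessLogDensity y θ‖ ≤ H y) :
    ∀ᵐ y ∂(M.law θ₀), ∀ h, ‖h‖ < r →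
      |M.logRatio θ₀ (θ₀ + h) y - M.score θ₀ y h| ≤ H y * ‖h‖ ^ 2 := by
  filter_upwards [hsm] with y hy h hh
  exact abs_sub_fderiv_le_of_norm_fderiv_fderiv_le hy.1 hy.2 hh

lemma ae_exists_abs_logRatio_sub_hess_le (hr : 0 < r)
    (hsm : ∀ᵐ y ∂(M.law θ₀), ContDiffOn ℝ 2 (M.logDensity y) (Metric.ball θ₀ r) ∧
      ∀ θ ∈ Metric.ball θ₀ r, ‖M.hessLogDensity y θ‖ ≤ H y) :
    ∀ᵐ y ∂(M.law θ₀), ∀ ε > 0, ∃ δ > 0, ∀ h, ‖h‖ < δ →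
      |M.logRatio θ₀ (θ₀ + h) y - M.score θ₀ y h - M.hessLogDensity y θ₀ h h / 2| ≤
        ε * ‖h‖ ^ 2 := by
  filter_upwards [hsm] with y hy ε hε
  exact exists_abs_sub_fderiv_sub_le hr hy.1 hε

lemma exists_seq_tendsto_zero_norm_smul_lt (hr : 0 < r) (u : EuclideanSpace ℝ (Fin p)) :
    ∃ t : ℕ → ℝ, (∀ j, 0 < t j) ∧ Tendsto t atTop (𝓝 0) ∧ ∀ j, ‖t j • u‖ < r := by
  have hpos : ∀ j : ℕ, 0 < r / (‖u‖ + 1) / ((j : ℝ) + 1) := fun j => by positivity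
  refine ⟨fun j => r / (‖u‖ + 1) / ((j : ℝ) + 1), hpos,
    tendsto_const_nhds.div_atTop (tendsto_atTop_add_const_right _ _ tendsto_natCast_atTop_atTop),
    fun j => ?_⟩
  rw [norm_smul, Real.norm_of_nonneg (hpos j).le]
  have h1 : r / (‖u‖ + 1) / ((j : ℝ) + 1) ≤ r / (‖u‖ + 1) :=
    div_le_self (by positivity) (by linarith [(Nat.cast_nonneg j : (0 : ℝ) ≤ j)])
  calc _ ≤ r / (‖u‖ + 1) * ‖u‖ := by gcongr
    _ < r / (‖u‖ + 1) * (‖u‖ + 1) := by gcongr; linarith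
    _ = r := by field_simp

/-- Measurability in the observation is given for the densities only; derivatives inherit it as
limits of difference quotients along a sequence. -/
lemma aemeasurable_score (hr : 0 < r) (hsub : Metric.ball θ₀ r ⊆ M.params)
    (hsm : ∀ᵐ y ∂(M.law θ₀), ContDiffOn ℝ 2 (M.logDensity y) (Metric.ball θ₀ r) ∧
      ∀ θ ∈ Metric.ball θ₀ r, ‖M.hessLogDensity y θ‖ ≤ H y) (u : EuclideanSpace ℝ (Fin p)) :
    AEMeasurable (fun y => M.score θ₀ y u) (M.law θ₀) := by
  obtain ⟨t, ht0, htlim, htr⟩ := exists_seq_tendsto_zero_norm_smul_lt hr u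
  have h₀ : θ₀ ∈ M.params := hsub (Metric.mem_ball_self hr)
  refine aemeasurable_of_tendsto_metrizable_ae atTop
    (f := fun j y => M.logRatio θ₀ (θ₀ + t j • u) y / t j) (fun j => ?_) ?_
  · exact ((measurable_logRatio h₀ (hsub (by simpa using htr j))).div_const _).aemeasurable
  · filter_upwards [ae_abs_logRatio_sub_score_le hsm] with y hy
    rw [tendsto_iff_norm_sub_tendsto_zero]
    have hlim : Tendsto (fun j => H y * ‖u‖ ^ 2 * t j) atTop (𝓝 0) := by
      simpa using htlim.const_mul (H y * ‖u‖ ^ 2)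
    refine squeeze_zero (fun _ => norm_nonneg _) (fun j => ?_) hlim
    have := hy _ (htr j)
    rw [map_smul, smul_eq_mul, norm_smul, Real.norm_of_nonneg (ht0 j).le] at this
    have e : M.logRatio θ₀ (θ₀ + t j • u) y / t j - M.score θ₀ y u =
        (M.logRatio θ₀ (θ₀ + t j • u) y - t j * M.score θ₀ y u) / t j := by
      field_simp [(ht0 j).ne']
    rw [e, Real.norm_eq_abs, abs_div, abs_of_pos (ht0 j), div_le_iff₀ (ht0 j)]
    linarith

lemma aemeasurable_hess_diag (hr : 0 < r) (hsub : Metric.ball θ₀ r ⊆ M.params)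
    (hsm : ∀ᵐ y ∂(M.law θ₀), ContDiffOn ℝ 2 (M.logDensity y) (Metric.ball θ₀ r) ∧
      ∀ θ ∈ Metric.ball θ₀ r, ‖M.hessLogDensity y θ‖ ≤ H y) (u : EuclideanSpace ℝ (Fin p)) :
    AEMeasurable (fun y => M.hessLogDensity y θ₀ u u) (M.law θ₀) := by
  obtain ⟨t, ht0, htlim, htr⟩ := exists_seq_tendsto_zero_norm_smul_lt hr u
  have h₀ : θ₀ ∈ M.params := hsub (Metric.mem_ball_self hr)
  refine aemeasurable_of_tendsto_metrizable_ae atTop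
    (f := fun j y => (M.logRatio θ₀ (θ₀ + t j • u) y - t j * M.score θ₀ y u) / (t j ^ 2 / 2))
    (fun j => ?_) ?_
  · exact ((measurable_logRatio h₀ (hsub (by simpa using htr j))).aemeasurable.sub
      ((aemeasurable_score hr hsub hsm u).const_mul _)).div_const _
  · filter_upwards [ae_exists_abs_logRatio_sub_hess_le hr hsm] with y hy
    rw [Metric.tendsto_atTop]
    intro ε hε
    obtain ⟨δ, hδ, hb⟩ := hy (ε / (4 * (‖u‖ ^ 2 + 1))) (by positivity)
    have hlim : Tendsto (fun j => t j * ‖u‖) atTop (𝓝 0) := by simpa using htlim.mul_const ‖u‖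
    obtain ⟨N, hN⟩ := eventually_atTop.1 ((tendsto_order.1 hlim).2 δ hδ)
    refine ⟨N, fun j hj => ?_⟩
    have hn : ‖t j • u‖ = t j * ‖u‖ := by rw [norm_smul, Real.norm_of_nonneg (ht0 j).le]
    have := hb (t j • u) (by rw [hn]; exact hN j hj)
    simp only [map_smul, smul_eq_mul, hn, smul_apply] at this
    have htj := ht0 j
    have e : (M.logRatio θ₀ (θ₀ + t j • u) y - t j * M.score θ₀ y u) / (t j ^ 2 / 2) -
        M.hessLogDensity y θ₀ u u = (M.logRatio θ₀ (θ₀ + t j • u) y - t j * M.score θ₀ y u -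
          t j * (t j * M.hessLogDensity y θ₀ u u) / 2) / (t j ^ 2 / 2) := by
      field_simp
    rw [Real.dist_eq, e, abs_div, abs_of_pos (by positivity : (0 : ℝ) < t j ^ 2 / 2),
      div_lt_iff₀ (by positivity)]
    refine this.trans_lt ?_
    have h2 : ε / (4 * (‖u‖ ^ 2 + 1)) * ‖u‖ ^ 2 ≤ ε / 4 := by
      rw [div_mul_eq_mul_div, div_le_div_iff₀ (by positivity) (by positivity)]
      nlinarith [sq_nonneg ‖u‖]
    calc ε / (4 * (‖u‖ ^ 2 + 1)) * (t j * ‖u‖) ^ 2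
        = (ε / (4 * (‖u‖ ^ 2 + 1)) * ‖u‖ ^ 2) * t j ^ 2 := by ring
      _ ≤ ε / 4 * t j ^ 2 := by gcongr
      _ < ε * (t j ^ 2 / 2) := by nlinarith [pow_pos htj 2]

/-- Mixed entries are measurable by polarization from the diagonal ones, and dominated by `H`. -/
lemma integrable_hess (hr : 0 < r) (hsub : Metric.ball θ₀ r ⊆ M.params)
    (hH : Integrable H (M.law θ₀))
    (hsm : ∀ᵐ y ∂(M.law θ₀), ContDiffOn ℝ 2 (M.logDensity y) (Metric.ball θ₀ r) ∧
      ∀ θ ∈ Metric.ball θ₀ r, ‖M.hessLogDensity y θ‖ ≤ H y) (u v : EuclideanSpace ℝ (Fin p)) :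
    Integrable (fun y => M.hessLogDensity y θ₀ u v) (M.law θ₀) := by
  have hmeas : AEMeasurable (fun y => M.hessLogDensity y θ₀ u v) (M.law θ₀) := by
    have hpol : AEMeasurable (fun y => (M.hessLogDensity y θ₀ (u + v) (u + v) -
        M.hessLogDensity y θ₀ u u - M.hessLogDensity y θ₀ v v) / 2) (M.law θ₀) :=
      (((aemeasurable_hess_diag hr hsub hsm _).sub (aemeasurable_hess_diag hr hsub hsm _)).sub
        (aemeasurable_hess_diag hr hsub hsm _)).div_const _
    refine hpol.congr ?_
    filter_upwards [hsm] with y hy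
    have hx : θ₀ ∈ Metric.ball θ₀ r := Metric.mem_ball_self hr
    have hc : ContDiffAt ℝ 2 (M.logDensity y) θ₀ :=
      (hy.1 θ₀ hx).contDiffAt (Metric.isOpen_ball.mem_nhds hx)
    have hsymm : M.hessLogDensity y θ₀ v u = M.hessLogDensity y θ₀ u v :=
      hc.isSymmSndFDerivAt (by simp) v u
    simp only [map_add, add_apply, hsymm]
    ring
  refine (hH.mul_const (‖u‖ * ‖v‖)).mono' hmeas.aestronglyMeasurable ?_
  filter_upwards [hsm] with y hy
  refine ((M.hessLogDensity y θ₀).le_opNorm₂ u v).trans ?_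
  rw [mul_assoc]
  gcongr
  exact hy.2 θ₀ (Metric.mem_ball_self hr)

lemma integral_hess_diag_neg (hr : 0 < r) (hsub : Metric.ball θ₀ r ⊆ M.params)
    (hH : Integrable H (M.law θ₀))
    (hsm : ∀ᵐ y ∂(M.law θ₀), ContDiffOn ℝ 2 (M.logDensity y) (Metric.ball θ₀ r) ∧
      ∀ θ ∈ Metric.ball θ₀ r, ‖M.hessLogDensity y θ‖ ≤ H y)
    (hpd : (M.fisherInformation θ₀).PosDef) {u : EuclideanSpace ℝ (Fin p)} (hu : u ≠ 0) :
    ∫ y, M.hessLogDensity y θ₀ u u ∂(M.law θ₀) < 0 := by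
  have hdec : u = ∑ m, u m • EuclideanSpace.single m (1 : ℝ) := by
    ext i
    simp [Pi.single_apply]
  have hexp : ∀ y, M.hessLogDensity y θ₀ u u = ∑ m, ∑ l, u m * u l *
      M.hessLogDensity y θ₀ (EuclideanSpace.single m 1) (EuclideanSpace.single l 1) := by
    intro y
    conv_lhs => rw [hdec]
    simp only [map_sum, map_smul, sum_apply, smul_apply,
      smul_eq_mul, Finset.mul_sum]
    rw [Finset.sum_comm]
    refine Finset.sum_congr rfl fun m _ => Finset.sum_congr rfl fun l _ => ?_
    ring
  have hint : ∫ y, M.hessLogDensity y θ₀ u u ∂(M.law θ₀) =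
      -∑ m, ∑ l, u m * u l * M.fisherInformation θ₀ m l := by
    simp_rw [hexp]
    rw [integral_finsetSum _ fun m _ => integrable_finsetSum _ fun l _ =>
      (integrable_hess hr hsub hH hsm _ _).const_mul _, ← Finset.sum_neg_distrib]
    refine Finset.sum_congr rfl fun m _ => ?_
    rw [integral_finsetSum _ fun l _ => (integrable_hess hr hsub hH hsm _ _).const_mul _,
      ← Finset.sum_neg_distrib]
    refine Finset.sum_congr rfl fun l _ => ?_
    rw [integral_const_mul, fisherInformation, Matrix.of_apply]
    ring
  have hu' : (u.ofLp : Fin p → ℝ) ≠ 0 := fun h => hu (by ext i; exact congrFun h i)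
  have hpos := hpd.dotProduct_mulVec_pos hu'
  rw [hint, neg_lt_zero]
  refine hpos.trans_eq ?_
  simp only [dotProduct, Matrix.mulVec, star_trivial, Finset.mul_sum]
  refine Finset.sum_congr rfl fun m _ => Finset.sum_congr rfl fun l _ => ?_
  ring

/-- By Taylor's bound the log-likelihood ratio at `θ₀ + t u` is at least `t s - H ‖u‖² t²`, so the
exponential moment criterion applies without differentiating under the integral. -/
lemma memLp_score_and_integral_score (hr : 0 < r) (hsub : Metric.ball θ₀ r ⊆ M.params)
    (hpos : ∀ᵐ y ∂(M.law θ₀), ∀ θ ∈ M.params, 0 < M.density θ y)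
    (hH : Integrable H (M.law θ₀))
    (hsm : ∀ᵐ y ∂(M.law θ₀), ContDiffOn ℝ 2 (M.logDensity y) (Metric.ball θ₀ r) ∧
      ∀ θ ∈ Metric.ball θ₀ r, ‖M.hessLogDensity y θ‖ ≤ H y) (u : EuclideanSpace ℝ (Fin p)) :
    MemLp (fun y => M.score θ₀ y u) 2 (M.law θ₀) ∧ ∫ y, M.score θ₀ y u ∂(M.law θ₀) = 0 := by
  have h₀ : θ₀ ∈ M.params := hsub (Metric.mem_ball_self hr)
  have := isProbabilityMeasure_law h₀
  refine memLp_two_and_integral_eq_zero_of_exp (H := fun y => H y * ‖u‖ ^ 2)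
    (t₀ := r / (‖u‖ + 1)) (by positivity) (aemeasurable_score hr hsub hsm u) (hH.mul_const _) ?_
  intro t ht
  have htu : ‖t • u‖ < r := by
    rw [norm_smul, Real.norm_eq_abs]
    rw [lt_div_iff₀ (by positivity)] at ht
    nlinarith [abs_nonneg t]
  refine le_trans (lintegral_mono_ae ?_)
    (lintegral_exp_logRatio_le_one h₀ hpos (hsub (by simpa using htu) : θ₀ + t • u ∈ M.params))
  filter_upwards [ae_abs_logRatio_sub_score_le hsm] with y hy
  refine ENNReal.ofReal_le_ofReal (Real.exp_le_exp.2 ?_)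
  have := (abs_le.1 (hy _ htu)).1
  rw [map_smul, smul_eq_mul, norm_smul, mul_pow, Real.norm_eq_abs, sq_abs] at this
  linarith

end BayesModel

/-! ### Uniform bounds for the log-likelihood ratio and the score of the sample. -/

namespace BayesModel

variable {Y : Type*} [MeasurableSpace Y] {p : ℕ} {M : BayesModel Y p}
  {θ₀ : EuclideanSpace ℝ (Fin p)} {Ω : Type*} [MeasurableSpace Ω] {μ : Measure Ω} {y : ℕ → Ω → Y}

/-- Wald's argument on a compact set of parameters. -/
lemma highProbability_sum_logRatio_le_of_isCompact (hreg : M.RegularAt θ₀)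
    (hy : IsIIDSample μ (M.law θ₀) y) {C : Set (EuclideanSpace ℝ (Fin p))} (hC : IsCompact C)
    (hCp : C ⊆ M.params) (hC₀ : θ₀ ∉ C) {G : Y → ℝ} (hG : Integrable G (M.law θ₀))
    (hCG : ∀ᵐ z ∂(M.law θ₀), ∀ θ ∈ C, M.logRatio θ₀ θ z ≤ G z) :
    ∃ c > 0, HighProbability μ fun n ω =>
      ∀ θ ∈ C, ∑ i ∈ Finset.range n, M.logRatio θ₀ θ (y i ω) ≤ -c * n := by
  have h₀ := hreg.mem_params
  have := isProbabilityMeasure_law h₀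
  have hcont : ∀ᵐ z ∂(M.law θ₀), ContinuousOn (fun θ => M.logRatio θ₀ θ z) M.params := by
    filter_upwards [hreg.density_pos, hreg.density_continuousOn] with z hp hc
    exact (hc.log fun θ hθ => (hp θ hθ).ne').sub continuousOn_const
  -- The property passes to subsets and finite unions, so by compactness it need only be checked
  -- near each point.
  refine hC.induction_on (p := fun S => ∃ c > 0, HighProbability μ fun n ω =>
      ∀ θ ∈ S, ∑ i ∈ Finset.range n, M.logRatio θ₀ θ (y i ω) ≤ -c * n) ?_ ?_ ?_ ?_
  · exact ⟨1, one_pos, HighProbability.of_ae (Eventually.of_forall fun n =>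
      ae_of_all _ fun ω θ hθ => absurd hθ (Set.notMem_empty θ))⟩
  · rintro s t hst ⟨c, hc, h⟩
    exact ⟨c, hc, h.mono fun n ω hω θ hθ => hω θ (hst hθ)⟩
  · rintro s t ⟨c, hc, h⟩ ⟨c', hc', h'⟩
    refine ⟨min c c', lt_min hc hc', (h.and h').mono fun n ω hω θ hθ => ?_⟩
    have hn : (0 : ℝ) ≤ n := Nat.cast_nonneg n
    rcases hθ with hθ | hθ
    · nlinarith [hω.1 θ hθ, min_le_left c c']
    · nlinarith [hω.2 θ hθ, min_le_right c c']
  · intro θ hθ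
    have hθp := hCp hθ
    have hne : ¬ M.logRatio θ₀ θ =ᵐ[M.law θ₀] 0 := fun h => hC₀
      (hreg.identifiable θ hθp (law_eq_of_logRatio_ae_eq_zero h₀ hreg.density_pos hθp h) ▸ hθ)
    -- The log ratio at `θ` may have mean `-∞`; truncating it from below gives an integrable `b` for
    -- the envelope lemma while keeping the mean negative.
    obtain ⟨A, hAi, hA⟩ := exists_integral_max_neg (measurable_logRatio h₀ hθp).aemeasurable hG
      (hCG.mono fun z hz => hz θ hθ) (lintegral_exp_logRatio_le_one h₀ hreg.density_pos hθp) hne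
    set D : ℕ → Set (EuclideanSpace ℝ (Fin p)) :=
      fun j => C ∩ Metric.ball θ (1 / ((j : ℝ) + 1)) with hD
    have hDanti : Antitone D := fun i j hij => by
      refine Set.inter_subset_inter_right _ (Metric.ball_subset_ball ?_)
      exact one_div_le_one_div_of_le (by positivity) (by gcongr)
    obtain ⟨j, φ, hφ, hφneg, hle⟩ := exists_integrable_envelope hDanti (F := M.logRatio θ₀)
      (fun x hx => (measurable_logRatio h₀ (hCp hx.1)).aemeasurable)
      (hcont.mono fun z hz => hz.mono fun x hx => hCp hx.1) hG hAi
      (hCG.mono fun z hz x hx => hz x hx.1) (by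
        filter_upwards [hcont] with z hz ε hε
        have hw := (hz.mono hCp) θ hθ
        obtain ⟨δ, hδ, hb⟩ := Metric.continuousWithinAt_iff.1 hw ε hε
        obtain ⟨j, hj⟩ := exists_nat_one_div_lt hδ
        refine ⟨j, fun x hx => ?_⟩
        have h1 := hb hx.1 ((Metric.mem_ball.1 hx.2).trans hj)
        rw [Real.dist_eq] at h1
        linarith [le_abs_self (M.logRatio θ₀ x z - M.logRatio θ₀ θ z),
          le_max_left (M.logRatio θ₀ θ z) (-A)]) hA
    refine ⟨D j, ?_, -(∫ z, φ z ∂(M.law θ₀)) / 2, by linarith, ?_⟩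
    · exact inter_mem self_mem_nhdsWithin (mem_nhdsWithin_of_mem_nhds
        (Metric.ball_mem_nhds _ (by positivity)))
    · refine (hy.highProbability_sum_le hφ (a := (∫ z, φ z ∂(M.law θ₀)) / 2)
        (by linarith)).mono_ae (Eventually.of_forall fun n => ?_)
      filter_upwards [hy.ae_all hle] with ω hω hs x hx
      have := Finset.sum_le_sum fun i (_ : i ∈ Finset.range n) => hω i x hx
      linarith

/-- Away from the true parameter, the log-likelihood ratio tends to `-∞` uniformly and linearly in
the sample size. -/
lemma highProbability_sum_logRatio_le_of_le_norm (hreg : M.RegularAt θ₀)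
    (hy : IsIIDSample μ (M.law θ₀) y) {δ : ℝ} (hδ : 0 < δ) :
    ∃ c > 0, HighProbability μ fun n ω => ∀ θ ∈ M.params, δ ≤ ‖θ - θ₀‖ →
      ∑ i ∈ Finset.range n, M.logRatio θ₀ θ (y i ω) ≤ -c * n := by
  obtain ⟨K, hK, hKp, ⟨G, hG, hKG⟩, ⟨k, hk, G', hG', hneg, hG'b⟩⟩ := hreg.wald
  obtain ⟨c, hc, h⟩ := highProbability_sum_logRatio_le_of_isCompact hreg hy
    (C := K \ Metric.ball θ₀ δ) (hK.diff Metric.isOpen_ball) (fun θ hθ => hKp hθ.1)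
    (fun h => h.2 (Metric.mem_ball_self hδ)) hG (hKG.mono fun z hz θ hθ => hz θ hθ.1)
  obtain ⟨c', hc', h'⟩ := hy.highProbability_forall_sum_le_of_block hk hG' hneg
    (T := M.params \ K) (x := M.logRatio θ₀) hG'b
  refine ⟨min c c', lt_min hc hc', (h.and h').mono fun n ω hω θ hθ hd => ?_⟩
  have hn : (0 : ℝ) ≤ n := Nat.cast_nonneg n
  by_cases hθK : θ ∈ K
  · have hb : θ ∉ Metric.ball θ₀ δ := by simpa [dist_eq_norm] using hd
    nlinarith [hω.1 θ ⟨hθK, hb⟩, min_le_left c c']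
  · nlinarith [hω.2 θ ⟨hθ, hθK⟩, min_le_right c c']

variable {r : ℝ} {H : Y → ℝ}

/-- Wald's argument is applied to `(logRatio - score) / t²` along `h = t u` with `u` on the unit
sphere. As `t → 0` and the direction tends to `u`, the quotient tends to half the Hessian form at
`u`, of negative mean, and `H` dominates it. -/
lemma exists_highProbability_sum_logRatio_le_of_norm_lt (hy : IsIIDSample μ (M.law θ₀) y)
    (hr : 0 < r) (hsub : Metric.ball θ₀ r ⊆ M.params) (hH : Integrable H (M.law θ₀))
    (hsm : ∀ᵐ y ∂(M.law θ₀), ContDiffOn ℝ 2 (M.logDensity y) (Metric.ball θ₀ r) ∧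
      ∀ θ ∈ Metric.ball θ₀ r, ‖M.hessLogDensity y θ‖ ≤ H y)
    (hpd : (M.fisherInformation θ₀).PosDef) :
    ∃ δ > 0, ∃ c > 0, HighProbability μ fun n ω => ∀ h, ‖h‖ < δ →
      ∑ i ∈ Finset.range n, M.logRatio θ₀ (θ₀ + h) (y i ω) ≤
        (∑ i ∈ Finset.range n, M.score θ₀ (y i ω)) h - c * n * ‖h‖ ^ 2 := by
  have h₀ : θ₀ ∈ M.params := hsub (Metric.mem_ball_self hr)
  have := isProbabilityMeasure_law h₀
  obtain ⟨δ, hδ, c, hc, hW⟩ : ∃ δ > 0, ∃ c > 0, HighProbability μ fun n ω =>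
      ∀ u ∈ Metric.sphere (0 : EuclideanSpace ℝ (Fin p)) 1, ∀ t, 0 < t → t < δ →
      ∑ i ∈ Finset.range n, M.logRatio θ₀ (θ₀ + t • u) (y i ω) ≤
        t * (∑ i ∈ Finset.range n, M.score θ₀ (y i ω) u) - c * n * t ^ 2 := by
    refine (isCompact_sphere (0 : EuclideanSpace ℝ (Fin p)) 1).induction_on
      (p := fun S => ∃ δ > 0, ∃ c > 0, HighProbability μ fun n ω =>
        ∀ u ∈ S, ∀ t, 0 < t → t < δ →
        ∑ i ∈ Finset.range n, M.logRatio θ₀ (θ₀ + t • u) (y i ω) ≤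
          t * (∑ i ∈ Finset.range n, M.score θ₀ (y i ω) u) - c * n * t ^ 2) ?_ ?_ ?_ ?_
    · exact ⟨1, one_pos, 1, one_pos, HighProbability.of_ae (Eventually.of_forall fun n =>
        ae_of_all _ fun ω θ hθ => absurd hθ (Set.notMem_empty θ))⟩
    · rintro s t hst ⟨δ, hδ, c, hc, h⟩
      exact ⟨δ, hδ, c, hc, h.mono fun n ω hω θ hθ => hω θ (hst hθ)⟩
    · rintro s s' ⟨δ, hδ, c, hc, h⟩ ⟨δ', hδ', c', hc', h'⟩
      refine ⟨min δ δ', lt_min hδ hδ', min c c', lt_min hc hc',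
        (h.and h').mono fun n ω hω u hu t ht0 ht => ?_⟩
      have hn : (0 : ℝ) ≤ n * t ^ 2 := by positivity
      rcases hu with hu | hu
      · nlinarith [hω.1 u hu t ht0 (ht.trans_le (min_le_left _ _)), min_le_left c c']
      · nlinarith [hω.2 u hu t ht0 (ht.trans_le (min_le_right _ _)), min_le_right c c']
    · intro u hu
      have hu1 : ‖u‖ = 1 := by simpa using hu
      have hu0 : u ≠ 0 := by rintro rfl; simp at hu1
      -- Directions near `u` paired with small `t > 0`: the value `t = 0` is excluded so that the
      -- quotient is continuous on `D 0`.
      set D : ℕ → Set (EuclideanSpace ℝ (Fin p) × ℝ) := fun j =>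
        (Metric.sphere 0 1 ∩ Metric.ball u (1 / ((j : ℝ) + 1))) ×ˢ
          Set.Ioo 0 (min r (1 / ((j : ℝ) + 1))) with hD
      have hDanti : Antitone D := fun i j hij => by
        have : 1 / ((j : ℝ) + 1) ≤ 1 / ((i : ℝ) + 1) :=
          one_div_le_one_div_of_le (by positivity) (by gcongr)
        exact Set.prod_mono (Set.inter_subset_inter_right _ (Metric.ball_subset_ball this))
          (Set.Ioo_subset_Ioo_right (min_le_min_left _ this))
      have hDr : ∀ j, ∀ x ∈ D j, ‖x.1‖ = 1 ∧ 0 < x.2 ∧ ‖x.2 • x.1‖ = x.2 ∧ ‖x.2 • x.1‖ < r := by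
        rintro j ⟨v, t⟩ ⟨⟨hv, -⟩, ht0, ht⟩
        have hv1 : ‖v‖ = 1 := by simpa using hv
        have : ‖t • v‖ = t := by rw [norm_smul, hv1, mul_one, Real.norm_of_nonneg ht0.le]
        exact ⟨hv1, ht0, this, this.trans_lt (ht.trans_le (min_le_left _ _))⟩
      obtain ⟨j, φ, hφ, hφneg, hle⟩ := exists_integrable_envelope hDanti
        (F := fun x z => (M.logRatio θ₀ (θ₀ + x.2 • x.1) z - M.score θ₀ z (x.2 • x.1)) / x.2 ^ 2)
        (P := M.law θ₀) (G := H) (b := fun z => M.hessLogDensity z θ₀ u u / 2) (a := 0)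
        (fun x hx => by
          refine AEMeasurable.div_const ?_ _
          refine (measurable_logRatio h₀ (hsub ?_)).aemeasurable.sub
            (aemeasurable_score hr hsub hsm _)
          simpa using (hDr 0 x hx).2.2.2)
        (by
          filter_upwards [hsm] with z hz
          have hc : ContinuousOn (M.logDensity z) (Metric.ball θ₀ r) := hz.1.continuousOn
          have hm : ContinuousOn (fun x : EuclideanSpace ℝ (Fin p) × ℝ => θ₀ + x.2 • x.1) (D 0) :=
            by fun_prop
          have hc' : ContinuousOn (fun x : EuclideanSpace ℝ (Fin p) × ℝ =>
              M.logDensity z (θ₀ + x.2 • x.1)) (D 0) :=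
            hc.comp hm fun x hx => by simpa using (hDr 0 x hx).2.2.2
          refine ((hc'.sub continuousOn_const).sub ?_).div (by fun_prop)
            fun x hx => (pow_pos (hDr 0 x hx).2.1 2).ne'
          fun_prop)
        hH ((integrable_hess hr hsub hH hsm u u).div_const 2)
        (by
          filter_upwards [ae_abs_logRatio_sub_score_le hsm] with z hz x hx
          obtain ⟨-, h2, h3, h4⟩ := hDr 0 x hx
          rw [div_le_iff₀ (by positivity)]
          have := (abs_le.1 (hz _ h4)).2
          rwa [h3] at this)
        (by
          filter_upwards [ae_exists_abs_logRatio_sub_hess_le hr hsm] with z hz ε hε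
          obtain ⟨δ₁, hδ₁, hb₁⟩ := hz (ε / 2) (by positivity)
          have hQ : Continuous fun v => M.hessLogDensity z θ₀ v v / 2 := by fun_prop
          obtain ⟨δ₂, hδ₂, hb₂⟩ := Metric.continuous_iff.1 hQ u (ε / 2) (by positivity)
          obtain ⟨j, hj⟩ := exists_nat_one_div_lt (lt_min hδ₁ hδ₂)
          refine ⟨j, fun x hx => ?_⟩
          obtain ⟨h1, h2, h3, h4⟩ := hDr j x hx
          have ht : x.2 < δ₁ := hx.2.2.trans_le (((min_le_right _ _).trans hj.le).trans
            (min_le_left _ _))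
          have hv : dist x.1 u < δ₂ := (Metric.mem_ball.1 hx.1.2).trans
            (hj.trans_le (min_le_right _ _))
          have e1 := (abs_le.1 (hb₁ (x.2 • x.1) (by rwa [h3]))).2
          have e2 := hb₂ x.1 hv
          rw [Real.dist_eq] at e2
          have e3 := (abs_lt.1 e2).2
          rw [h3] at e1
          rw [div_le_iff₀ (by positivity)]
          have e4 : M.hessLogDensity z θ₀ (x.2 • x.1) (x.2 • x.1) =
              x.2 ^ 2 * M.hessLogDensity z θ₀ x.1 x.1 := by
            simp only [map_smul, smul_apply, smul_eq_mul]
            ring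
          rw [e4] at e1
          have hx2 : 0 < x.2 ^ 2 := by positivity
          nlinarith)
        (by
          rw [integral_div]
          linarith [integral_hess_diag_neg hr hsub hH hsm hpd hu0])
      refine ⟨Metric.sphere 0 1 ∩ Metric.ball u (1 / ((j : ℝ) + 1)), ?_,
        min r (1 / ((j : ℝ) + 1)), lt_min hr (by positivity),
        -(∫ z, φ z ∂(M.law θ₀)) / 2, by linarith, ?_⟩
      · exact inter_mem self_mem_nhdsWithin (mem_nhdsWithin_of_mem_nhds
          (Metric.ball_mem_nhds _ (by positivity)))
      · refine (hy.highProbability_sum_le hφ (a := (∫ z, φ z ∂(M.law θ₀)) / 2)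
          (by linarith)).mono_ae (Eventually.of_forall fun n => ?_)
        filter_upwards [hy.ae_all hle] with ω hω hs v hv t ht0 ht
        have hterm : ∀ i, M.logRatio θ₀ (θ₀ + t • v) (y i ω) ≤
            t * M.score θ₀ (y i ω) v + φ (y i ω) * t ^ 2 := by
          intro i
          have := hω i (v, t) ⟨hv, ht0, ht⟩
          simp only [map_smul, smul_eq_mul] at this
          rw [div_le_iff₀ (by positivity)] at this
          linarith
        have hsum := Finset.sum_le_sum fun i (_ : i ∈ Finset.range n) => hterm i
        rw [Finset.sum_add_distrib, ← Finset.mul_sum, ← Finset.sum_mul] at hsum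
        nlinarith [sq_nonneg t]
  refine ⟨δ, hδ, c, hc, hW.mono fun n ω hω h hh => ?_⟩
  rcases eq_or_ne h 0 with rfl | hne
  · simp [logRatio]
  · have hpos : 0 < ‖h‖ := norm_pos_iff.2 hne
    have := hω (‖h‖⁻¹ • h) (by simp [norm_smul, hpos.ne']) ‖h‖ hpos hh
    rw [smul_smul, mul_inv_cancel₀ hpos.ne', one_smul] at this
    refine this.trans_eq ?_
    simp only [map_smul, smul_eq_mul, sum_apply]
    rw [← Finset.mul_sum, ← mul_assoc, mul_inv_cancel₀ hpos.ne', one_mul]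

/-- Only the crude remainder `H ‖h‖²` and the law of large numbers for `H` are needed. -/
lemma highProbability_le_sum_logRatio (hy : IsIIDSample μ (M.law θ₀) y)
    (hH : Integrable H (M.law θ₀))
    (hsm : ∀ᵐ y ∂(M.law θ₀), ContDiffOn ℝ 2 (M.logDensity y) (Metric.ball θ₀ r) ∧
      ∀ θ ∈ Metric.ball θ₀ r, ‖M.hessLogDensity y θ‖ ≤ H y) :
    ∃ C > 0, HighProbability μ fun n ω => ∀ h, ‖h‖ < r →
      (∑ i ∈ Finset.range n, M.score θ₀ (y i ω)) h - C * n * ‖h‖ ^ 2 ≤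
        ∑ i ∈ Finset.range n, M.logRatio θ₀ (θ₀ + h) (y i ω) := by
  refine ⟨|∫ z, H z ∂(M.law θ₀)| + 1, by positivity, (hy.highProbability_sum_le hH
    (a := |∫ z, H z ∂(M.law θ₀)| + 1) (by linarith [le_abs_self (∫ z, H z ∂(M.law θ₀))])).mono_ae
    (Eventually.of_forall fun n => ?_)⟩
  filter_upwards [hy.ae_all (ae_abs_logRatio_sub_score_le hsm)] with ω hω hs h hh
  have hterm : ∀ i, M.score θ₀ (y i ω) h - H (y i ω) * ‖h‖ ^ 2 ≤
      M.logRatio θ₀ (θ₀ + h) (y i ω) := fun i => by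
    have := (abs_le.1 (hω i h hh)).1
    linarith
  have hsum := Finset.sum_le_sum fun i (_ : i ∈ Finset.range n) => hterm i
  rw [Finset.sum_sub_distrib, ← Finset.sum_mul] at hsum
  rw [sum_apply]
  nlinarith [sq_nonneg ‖h‖]

lemma norm_le_sum_abs_apply_single (S : EuclideanSpace ℝ (Fin p) →L[ℝ] ℝ) :
    ‖S‖ ≤ ∑ m, |S (EuclideanSpace.single m 1)| := by
  refine S.opNorm_le_bound (Finset.sum_nonneg fun m _ => abs_nonneg _) fun h => ?_
  have hdec : h = ∑ m, h m • EuclideanSpace.single m (1 : ℝ) := by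
    ext i
    simp [Pi.single_apply]
  conv_lhs => rw [hdec]
  rw [map_sum, Finset.sum_mul]
  refine (norm_sum_le _ _).trans (Finset.sum_le_sum fun m _ => ?_)
  rw [map_smul, norm_smul, mul_comm, Real.norm_eq_abs]
  gcongr
  exact PiLp.norm_apply_le h m

/-- The score of a sample of size `n` is of order `√n` in probability. -/
lemma exists_measure_sqrt_lt_norm_sum_score_le [IsProbabilityMeasure μ]
    (hy : IsIIDSample μ (M.law θ₀) y)
    (hmem : ∀ u, MemLp (fun z => M.score θ₀ z u) 2 (M.law θ₀))
    (hmean : ∀ u, ∫ z, M.score θ₀ z u ∂(M.law θ₀) = 0) {ε : ENNReal} (hε : 0 < ε) :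
    ∃ A : ℝ, 0 < A ∧ ∀ n : ℕ, 0 < n →
      μ {ω | A * √n < ‖∑ i ∈ Finset.range n, M.score θ₀ (y i ω)‖} ≤ ε := by
  set e : Fin p → EuclideanSpace ℝ (Fin p) := fun m => EuclideanSpace.single m 1 with he
  set V : Fin p → ℝ := fun m => variance (fun z => M.score θ₀ z (e m)) (M.law θ₀) with hV
  have hcheb : ∀ (m : Fin p) (A : ℝ), 0 < A → ∀ n : ℕ, 0 < n →
      μ {ω | A * √n ≤ |∑ i ∈ Finset.range n, M.score θ₀ (y i ω) (e m)|} ≤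
        ENNReal.ofReal (V m / A ^ 2) := by
    intro m A hA n hn
    have hmp := fun i => hy.measurePreserving i
    have hLp : ∀ i, MemLp (fun ω => M.score θ₀ (y i ω) (e m)) 2 μ := fun i =>
      (hmem (e m)).comp_measurePreserving (hmp i)
    have hvar : ∀ i, variance (fun ω => M.score θ₀ (y i ω) (e m)) μ = V m := by
      intro i
      have h1 := variance_map (μ := μ) (X := fun z => M.score θ₀ z (e m)) (Y := y i)
        (by rw [hy.map_eq]; exact (hmem (e m)).aestronglyMeasurable.aemeasurable)
        (hy.measurable i).aemeasurable
      rw [hy.map_eq] at h1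
      exact h1.symm
    have hmean0 : ∀ i, ∫ ω, M.score θ₀ (y i ω) (e m) ∂μ = 0 := by
      intro i
      have h1 := integral_map (hy.measurable i).aemeasurable (f := fun z => M.score θ₀ z (e m))
        (μ := μ) (by rw [hy.map_eq]; exact (hmem (e m)).aestronglyMeasurable)
      rw [hy.map_eq, hmean] at h1
      exact h1.symm
    have hvs := IndepFun.variance_sum (μ := μ) (s := Finset.range n)
      (X := fun i ω => M.score θ₀ (y i ω) (e m)) (fun i _ => hLp i) (by
        intro i _ j _ hij
        refine (hy.indep.indepFun hij).comp₀ (hy.measurable _).aemeasurable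
          (hy.measurable _).aemeasurable (φ := fun z => M.score θ₀ z (e m))
          (ψ := fun z => M.score θ₀ z (e m)) ?_ ?_ <;> rw [hy.map_eq] <;>
          exact (hmem (e m)).aestronglyMeasurable.aemeasurable)
    have hn' : (0 : ℝ) < n := by exact_mod_cast hn
    have hch := meas_ge_le_variance_div_sq (μ := μ)
      (memLp_finsetSum' (Finset.range n) fun i _ => hLp i) (c := A * √n) (by positivity)
    rw [hvs] at hch
    simp only [hvar, Finset.sum_const, Finset.card_range, nsmul_eq_mul, Finset.sum_apply] at hch
    rw [integral_finsetSum _ fun i _ => (hLp i).integrable one_le_two] at hch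
    simp only [hmean0, Finset.sum_const_zero, sub_zero] at hch
    refine hch.trans_eq ?_
    congr 1
    rw [mul_pow, Real.sq_sqrt hn'.le]
    field_simp
  -- The threshold is shared among the `p` coordinates; dividing by `p + 1` also covers `p = 0`.
  have hlim : Tendsto (fun A : ℝ => ∑ m, ENNReal.ofReal (V m / (A / (p + 1)) ^ 2)) atTop
      (𝓝 0) := by
    rw [← Finset.sum_const_zero (s := (Finset.univ : Finset (Fin p)))]
    refine tendsto_finsetSum _ fun m _ => ?_
    rw [← ENNReal.ofReal_zero]
    refine ENNReal.tendsto_ofReal ?_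
    refine tendsto_const_nhds.div_atTop ?_
    exact (tendsto_pow_atTop two_ne_zero).comp (tendsto_id.atTop_div_const (by positivity))
  obtain ⟨A, hA0, hA⟩ := ((eventually_gt_atTop 0).and ((tendsto_order.1 hlim).2 ε hε)).exists
  refine ⟨A, hA0, fun n hn => ?_⟩
  refine le_trans ?_ ((Finset.sum_le_sum fun m (_ : m ∈ Finset.univ) =>
    hcheb m (A / (p + 1)) (by positivity) n hn).trans hA.le)
  refine le_trans (measure_mono fun ω hω => ?_) (measure_biUnion_finset_le _ _)
  by_contra hcon
  simp only [Finset.mem_univ, Set.iUnion_true, Set.mem_iUnion, Set.mem_ofPred_eq, not_exists,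
    not_le] at hcon hω
  have h1 := norm_le_sum_abs_apply_single (∑ i ∈ Finset.range n, M.score θ₀ (y i ω))
  have h2 : ∑ m, |(∑ i ∈ Finset.range n, M.score θ₀ (y i ω)) (EuclideanSpace.single m 1)| ≤
      ∑ m : Fin p, A / (p + 1) * √n := Finset.sum_le_sum fun m _ => by
    rw [sum_apply]; exact (hcon m).le
  have h3 : ∑ m : Fin p, A / ((p : ℝ) + 1) * √n ≤ A * √n := by
    simp only [Finset.sum_const, Finset.card_univ, Fintype.card_fin, nsmul_eq_mul]
    rw [← mul_assoc]
    gcongr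
    rw [mul_div_assoc', div_le_iff₀ (by positivity)]
    nlinarith
  linarith

end BayesModel

/-! ### Gaussian integrals and completing the square. -/

lemma lintegral_exp_neg_mul_sq_norm_sub {p : ℕ} {b : ℝ} (hb : 0 < b)
    (θ₀ : EuclideanSpace ℝ (Fin p)) :
    ∫⁻ θ, ENNReal.ofReal (Real.exp (-b * ‖θ - θ₀‖ ^ 2)) =
      ENNReal.ofReal ((Real.pi / b) ^ ((p : ℝ) / 2)) := by
  rw [lintegral_sub_right_eq_self
    (fun v : EuclideanSpace ℝ (Fin p) => ENNReal.ofReal (Real.exp (-b * ‖v‖ ^ 2))) θ₀]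
  have h := GaussianFourier.integral_rexp_neg_mul_sq_norm (V := EuclideanSpace ℝ (Fin p)) hb
  rw [finrank_euclideanSpace_fin] at h
  have hpos : 0 < (Real.pi / b) ^ ((p : ℝ) / 2) := Real.rpow_pos_of_pos (by positivity) _
  -- A non-integrable function would have integral `0` by convention, contradicting the positive
  -- value.
  have hint : Integrable fun v : EuclideanSpace ℝ (Fin p) => Real.exp (-b * ‖v‖ ^ 2) := by
    by_contra hn
    rw [integral_undef hn] at h
    exact hpos.ne h
  rw [← h, ofReal_integral_eq_lintegral_ofReal hint (ae_of_all _ fun v => (Real.exp_pos _).le)]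

/-- Half of the quadratic term is kept, so that the bound remains integrable as a Gaussian. -/
lemma mul_sub_sq_le {A c x : ℝ} (hc : 0 < c) :
    A * x - c * x ^ 2 ≤ A ^ 2 / (2 * c) - c / 2 * x ^ 2 := by
  have h : A ^ 2 / (2 * c) - c / 2 * x ^ 2 - (A * x - c * x ^ 2) = c / 2 * (x - A / c) ^ 2 := by
    field_simp
    ring
  nlinarith [mul_nonneg (half_pos hc).le (sq_nonneg (x - A / c))]

/-- A linear form of norm at most `A √n` minus a quadratic form of size `c n`. -/
lemma apply_sub_mul_sq_norm_le {E : Type*} [NormedAddCommGroup E] [NormedSpace ℝ E]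
    {S : E →L[ℝ] ℝ} {A c : ℝ} {n : ℕ} (hc : 0 < c) (hS : ‖S‖ ≤ A * √n) (h : E) :
    S h - c * n * ‖h‖ ^ 2 ≤ A ^ 2 / (2 * c) - c * n / 2 * ‖h‖ ^ 2 := by
  have h1 : S h ≤ A * (√n * ‖h‖) :=
    (le_abs_self _).trans ((S.le_of_opNorm_le hS h).trans_eq (by ring))
  have h2 := mul_sub_sq_le (A := A) (x := √n * ‖h‖) hc
  have h3 : (√n * ‖h‖) ^ 2 = n * ‖h‖ ^ 2 := by rw [mul_pow, Real.sq_sqrt (Nat.cast_nonneg n)]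
  rw [h3] at h2
  nlinarith

/-! ### Bounds for the marginal likelihood of a fixed sample. -/

namespace BayesModel

variable {Y : Type*} [MeasurableSpace Y] {p : ℕ} {M : BayesModel Y p}
  {θ₀ : EuclideanSpace ℝ (Fin p)}

section Deterministic

variable {z : ℕ → Y}

lemma likelihood_pos (hz : ∀ i, ∀ θ ∈ M.params, 0 < M.density θ (z i)) (n : ℕ)
    {θ : EuclideanSpace ℝ (Fin p)} (hθ : θ ∈ M.params) :
    0 < M.likelihood (fun i : Fin n => z i) θ :=
  Finset.prod_pos fun i _ => hz i θ hθ

lemma likelihood_eq_mul_exp (hz : ∀ i, ∀ θ ∈ M.params, 0 < M.density θ (z i)) (n : ℕ)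
    (h₀ : θ₀ ∈ M.params) {θ : EuclideanSpace ℝ (Fin p)} (hθ : θ ∈ M.params) :
    M.likelihood (fun i : Fin n => z i) θ = M.likelihood (fun i : Fin n => z i) θ₀ *
      Real.exp (∑ i ∈ Finset.range n, M.logRatio θ₀ θ (z i)) := by
  rw [likelihood, likelihood, Finset.sum_range, Real.exp_sum, ← Finset.prod_mul_distrib]
  refine Finset.prod_congr rfl fun i _ => ?_
  rw [logRatio, logDensity, logDensity, Real.exp_sub, Real.exp_log (hz i θ hθ),
    Real.exp_log (hz i θ₀ h₀), mul_div_cancel₀ _ (hz i θ₀ h₀).ne']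

/-- Upper bound for the contribution of a neighbourhood of `θ₀` to the marginal likelihood. -/
lemma lintegral_ball_le (hz : ∀ i, ∀ θ ∈ M.params, 0 < M.density θ (z i)) {n : ℕ} (hn : 0 < n)
    (h₀ : θ₀ ∈ M.params) {A c δ b : ℝ} (hc : 0 < c) (hb : 0 ≤ b)
    (hprior : ∀ θ ∈ Metric.ball θ₀ δ, M.prior θ ≤ b)
    (hS : ‖∑ i ∈ Finset.range n, M.score θ₀ (z i)‖ ≤ A * √n)
    (hloc : ∀ h, ‖h‖ < δ → ∑ i ∈ Finset.range n, M.logRatio θ₀ (θ₀ + h) (z i) ≤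
      (∑ i ∈ Finset.range n, M.score θ₀ (z i)) h - c * n * ‖h‖ ^ 2) :
    ∫⁻ θ in M.params ∩ Metric.ball θ₀ δ,
        ENNReal.ofReal (M.likelihood (fun i : Fin n => z i) θ * M.prior θ) ≤
      ENNReal.ofReal (M.likelihood (fun i : Fin n => z i) θ₀ *
        (b * Real.exp (A ^ 2 / (2 * c)) * (2 * Real.pi / c) ^ ((p : ℝ) / 2)) *
        (n : ℝ) ^ (-((p : ℝ) / 2))) := by
  have hn' : (0 : ℝ) < n := by exact_mod_cast hn
  have hL := likelihood_pos hz n h₀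
  set L₀ := M.likelihood (fun i : Fin n => z i) θ₀
  have hpt : ∀ θ ∈ M.params ∩ Metric.ball θ₀ δ,
      ENNReal.ofReal (M.likelihood (fun i : Fin n => z i) θ * M.prior θ) ≤
      ENNReal.ofReal (L₀ * (b * Real.exp (A ^ 2 / (2 * c)))) *
        ENNReal.ofReal (Real.exp (-(c * n / 2) * ‖θ - θ₀‖ ^ 2)) := by
    rintro θ ⟨hθ, hθb⟩
    rw [← ENNReal.ofReal_mul (by positivity)]
    refine ENNReal.ofReal_le_ofReal ?_
    have h1 := hloc (θ - θ₀) (by rwa [← dist_eq_norm])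
    have h2 := apply_sub_mul_sq_norm_le hc hS (θ - θ₀)
    rw [add_sub_cancel] at h1
    rw [likelihood_eq_mul_exp hz n h₀ hθ]
    calc L₀ * Real.exp (∑ i ∈ Finset.range n, M.logRatio θ₀ θ (z i)) * M.prior θ
        ≤ L₀ * Real.exp (A ^ 2 / (2 * c) + -(c * n / 2) * ‖θ - θ₀‖ ^ 2) * b := by
          gcongr
          · exact M.prior_nonneg θ hθ
          · linarith
          · exact hprior θ hθb
      _ = _ := by rw [Real.exp_add]; ring
  calc _ ≤ ∫⁻ θ in M.params ∩ Metric.ball θ₀ δ,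
        ENNReal.ofReal (L₀ * (b * Real.exp (A ^ 2 / (2 * c)))) *
        ENNReal.ofReal (Real.exp (-(c * n / 2) * ‖θ - θ₀‖ ^ 2)) :=
        setLIntegral_mono' (M.measurableSet_params.inter measurableSet_ball) hpt
    _ ≤ ∫⁻ θ, ENNReal.ofReal (L₀ * (b * Real.exp (A ^ 2 / (2 * c)))) *
        ENNReal.ofReal (Real.exp (-(c * n / 2) * ‖θ - θ₀‖ ^ 2)) := setLIntegral_le_lintegral _ _
    _ = ENNReal.ofReal (L₀ * (b * Real.exp (A ^ 2 / (2 * c)))) *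
        ENNReal.ofReal ((Real.pi / (c * n / 2)) ^ ((p : ℝ) / 2)) := by
        rw [lintegral_const_mul' _ _ ENNReal.ofReal_ne_top,
          lintegral_exp_neg_mul_sq_norm_sub (by positivity)]
    _ = _ := by
        rw [← ENNReal.ofReal_mul (by positivity)]
        have : Real.pi / (c * n / 2) = 2 * Real.pi / c * (n : ℝ)⁻¹ := by field_simp
        rw [this, Real.mul_rpow (by positivity) (by positivity), Real.inv_rpow hn'.le,
          ← Real.rpow_neg hn'.le]
        congr 1
        ring

/-- Upper bound for the contribution of the complement of a neighbourhood of `θ₀` to the marginal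
likelihood of `m + n` observations. -/
lemma lintegral_diff_ball_le (hz : ∀ i, ∀ θ ∈ M.params, 0 < M.density θ (z i)) {m n : ℕ}
    (h₀ : θ₀ ∈ M.params) {c δ : ℝ}
    (hglob : ∀ θ ∈ M.params, δ ≤ ‖θ - θ₀‖ →
      ∑ i ∈ Finset.range n, M.logRatio θ₀ θ (z (m + i)) ≤ -c * n) :
    ∫⁻ θ in M.params \ Metric.ball θ₀ δ,
        ENNReal.ofReal (M.likelihood (fun i : Fin (m + n) => z i) θ * M.prior θ) ≤
      ENNReal.ofReal (M.likelihood (fun i : Fin (m + n) => z i) θ₀ *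
        (Real.exp (-c * n) / M.likelihood (fun i : Fin m => z i) θ₀)) *
        M.marginalLikelihood (fun i : Fin m => z i) := by
  have hLm := likelihood_pos hz m h₀
  have hL := likelihood_pos hz (m + n) h₀
  set Lm := M.likelihood (fun i : Fin m => z i) θ₀ with hLm_def
  set L₀ := M.likelihood (fun i : Fin (m + n) => z i) θ₀
  -- The likelihood of the first `m` observations stays with the prior, to be integrated to the
  -- marginal likelihood; only the last `n` factors are bounded.
  have hpt : ∀ θ ∈ M.params \ Metric.ball θ₀ δ,
      ENNReal.ofReal (M.likelihood (fun i : Fin (m + n) => z i) θ * M.prior θ) ≤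
      ENNReal.ofReal (L₀ * (Real.exp (-c * n) / Lm)) *
        ENNReal.ofReal (M.likelihood (fun i : Fin m => z i) θ * M.prior θ) := by
    rintro θ ⟨hθ, hθb⟩
    rw [← ENNReal.ofReal_mul (by positivity)]
    refine ENNReal.ofReal_le_ofReal ?_
    have h1 := hglob θ hθ (by simpa [dist_eq_norm] using hθb)
    have hg := M.prior_nonneg θ hθ
    rw [likelihood_eq_mul_exp hz (m + n) h₀ hθ, likelihood_eq_mul_exp hz m h₀ hθ,
      Finset.sum_range_add, Real.exp_add, ← hLm_def]
    calc L₀ * (Real.exp (∑ i ∈ Finset.range m, M.logRatio θ₀ θ (z i)) *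
          Real.exp (∑ i ∈ Finset.range n, M.logRatio θ₀ θ (z (m + i)))) * M.prior θ
        ≤ L₀ * (Real.exp (∑ i ∈ Finset.range m, M.logRatio θ₀ θ (z i)) *
          Real.exp (-c * n)) * M.prior θ := by gcongr
      _ = _ := by field_simp
  calc _ ≤ ∫⁻ θ in M.params \ Metric.ball θ₀ δ, ENNReal.ofReal (L₀ * (Real.exp (-c * n) / Lm)) *
        ENNReal.ofReal (M.likelihood (fun i : Fin m => z i) θ * M.prior θ) :=
        setLIntegral_mono' (M.measurableSet_params.diff measurableSet_ball) hpt
    _ ≤ ∫⁻ θ in M.params, ENNReal.ofReal (L₀ * (Real.exp (-c * n) / Lm)) *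
        ENNReal.ofReal (M.likelihood (fun i : Fin m => z i) θ * M.prior θ) :=
        lintegral_mono_set Set.sdiff_subset
    _ = _ := by rw [lintegral_const_mul' _ _ ENNReal.ofReal_ne_top, marginalLikelihood]

/-- Lower bound for the marginal likelihood. -/
lemma le_marginalLikelihood (hz : ∀ i, ∀ θ ∈ M.params, 0 < M.density θ (z i)) {n : ℕ} (hn : 0 < n)
    (h₀ : θ₀ ∈ M.params) {A C δ b : ℝ} (hC : 0 < C) (hb : 0 ≤ b)
    (hsub : Metric.ball θ₀ δ ⊆ M.params) (hδ : 1 / √n ≤ δ)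
    (hprior : ∀ θ ∈ Metric.ball θ₀ δ, b ≤ M.prior θ)
    (hS : ‖∑ i ∈ Finset.range n, M.score θ₀ (z i)‖ ≤ A * √n)
    (hloc : ∀ h, ‖h‖ < δ → (∑ i ∈ Finset.range n, M.score θ₀ (z i)) h - C * n * ‖h‖ ^ 2 ≤
      ∑ i ∈ Finset.range n, M.logRatio θ₀ (θ₀ + h) (z i)) :
    ENNReal.ofReal (M.likelihood (fun i : Fin n => z i) θ₀ *
        (b * Real.exp (-A - C) *
          (volume (Metric.ball (0 : EuclideanSpace ℝ (Fin p)) 1)).toReal) *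
        (n : ℝ) ^ (-((p : ℝ) / 2))) ≤
      M.marginalLikelihood (fun i : Fin n => z i) := by
  have hn' : (0 : ℝ) < n := by exact_mod_cast hn
  have hs : 0 < √(n : ℝ) := Real.sqrt_pos.2 hn'
  have hL := likelihood_pos hz n h₀
  set L₀ := M.likelihood (fun i : Fin n => z i) θ₀
  -- At distance below `1/√n` the linear term is at least `-A` and the quadratic one at least `-C`,
  -- while the ball has volume of order `n^(-p/2)`.
  have hpt : ∀ θ ∈ Metric.ball θ₀ (1 / √n), ENNReal.ofReal (L₀ * (b * Real.exp (-A - C))) ≤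
      ENNReal.ofReal (M.likelihood (fun i : Fin n => z i) θ * M.prior θ) := by
    intro θ hθ
    have hθ' := Metric.ball_subset_ball hδ hθ
    have hθn : ‖θ - θ₀‖ < 1 / √n := by rwa [← dist_eq_norm]
    refine ENNReal.ofReal_le_ofReal ?_
    have h1 := hloc (θ - θ₀) (hθn.trans_le hδ)
    rw [add_sub_cancel] at h1
    rw [likelihood_eq_mul_exp hz n h₀ (hsub hθ')]
    have hx : √n * ‖θ - θ₀‖ ≤ 1 := by
      rw [lt_div_iff₀ hs] at hθn
      linarith
    have hx0 : 0 ≤ √n * ‖θ - θ₀‖ := by positivity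
    have hA : 0 ≤ A := by
      by_contra h
      have := (norm_nonneg _).trans hS
      nlinarith
    have h2 : -A ≤ (∑ i ∈ Finset.range n, M.score θ₀ (z i)) (θ - θ₀) := by
      have h3 := ((∑ i ∈ Finset.range n, M.score θ₀ (z i)).le_of_opNorm_le hS (θ - θ₀))
      have h4 := (abs_le.1 h3).1
      nlinarith
    have h3 : (n : ℝ) * ‖θ - θ₀‖ ^ 2 ≤ 1 := by
      have : (n : ℝ) * ‖θ - θ₀‖ ^ 2 = (√n * ‖θ - θ₀‖) ^ 2 := by
        rw [mul_pow, Real.sq_sqrt hn'.le]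
      rw [this]
      nlinarith
    calc L₀ * (b * Real.exp (-A - C)) = L₀ * Real.exp (-A - C) * b := by ring
      _ ≤ L₀ * Real.exp (∑ i ∈ Finset.range n, M.logRatio θ₀ θ (z i)) * M.prior θ := by
        gcongr
        · nlinarith
        · exact hprior θ hθ'
  have hvol : volume (Metric.ball θ₀ (1 / √n)) =
      ENNReal.ofReal ((n : ℝ) ^ (-((p : ℝ) / 2)) *
        (volume (Metric.ball (0 : EuclideanSpace ℝ (Fin p)) 1)).toReal) := by
    rw [Measure.addHaar_ball_of_pos _ _ (by positivity), finrank_euclideanSpace_fin,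
      ENNReal.ofReal_mul (by positivity), ENNReal.ofReal_toReal measure_ball_lt_top.ne]
    congr 2
    rw [one_div, inv_pow, Real.rpow_neg hn'.le, Real.sqrt_eq_rpow, ← Real.rpow_mul_natCast hn'.le]
    congr 2
    ring
  calc _ = ENNReal.ofReal (L₀ * (b * Real.exp (-A - C))) * volume (Metric.ball θ₀ (1 / √n)) := by
        rw [hvol, ← ENNReal.ofReal_mul (by positivity)]
        congr 1
        ring
    _ = ∫⁻ _ in Metric.ball θ₀ (1 / √n), ENNReal.ofReal (L₀ * (b * Real.exp (-A - C))) := by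
        rw [setLIntegral_const]
    _ ≤ ∫⁻ θ in Metric.ball θ₀ (1 / √n),
        ENNReal.ofReal (M.likelihood (fun i : Fin n => z i) θ * M.prior θ) :=
        setLIntegral_mono' measurableSet_ball hpt
    _ ≤ _ := lintegral_mono_set ((Metric.ball_subset_ball hδ).trans hsub)

end Deterministic

/-- The marginal likelihood is almost everywhere equal to a measurable function of the sample. -/
lemma exists_measurable_marginalLikelihood
    (hcont : ∀ᵐ y ∂(M.law θ₀), ContinuousOn (fun θ => M.density θ y) M.params) (m : ℕ) :
    ∃ (s : Set Y) (Q : (Fin m → Y) → ENNReal), Measurable Q ∧ (∀ᵐ y ∂(M.law θ₀), y ∈ s) ∧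
      ∀ z : Fin m → Y, (∀ i, z i ∈ s) → Q z = M.marginalLikelihood z := by
  obtain ⟨t, hst, htm, ht0⟩ := exists_measurable_superset_of_null (ae_iff.1 hcont)
  have hts : ∀ y ∈ tᶜ, ContinuousOn (fun θ => M.density θ y) M.params := by
    intro y hy
    by_contra h
    exact hy (hst h)
  -- Setting the density to zero on a measurable null set makes it continuous in the parameter for
  -- every observation; with measurability in the sample this gives joint measurability, hence a
  -- measurable integral.
  set u : M.params → (Fin m → Y) → ℝ :=
    fun θ z => ∏ i, tᶜ.indicator (fun y => M.density θ.1 y) (z i) with hu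
  have huc : ∀ z, Continuous fun θ => u θ z := by
    intro z
    refine continuous_finsetProd _ fun i _ => ?_
    by_cases hzi : z i ∈ tᶜ
    · simp only [Set.indicator_of_mem hzi]
      exact continuousOn_iff_continuous_domRestrict.1 (hts _ hzi)
    · simp only [Set.indicator_of_notMem hzi]
      exact continuous_const
  have hum : ∀ θ, Measurable (u θ) := fun θ =>
    Finset.measurable_fun_prod _ fun i _ =>
      ((M.measurable_density θ.1 θ.2).indicator htm.compl).comp (measurable_pi_apply i)
  have hjoint : Measurable (Function.uncurry u) :=
    measurable_uncurry_of_continuous_of_measurable huc hum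
  have : SFinite (Measure.comap (Subtype.val : M.params → _)
      (volume : Measure (EuclideanSpace ℝ (Fin p)))) := by
    have : SigmaFinite (Measure.comap (Subtype.val : M.params → _)
      (volume : Measure (EuclideanSpace ℝ (Fin p)))) := by
      refine SigmaFinite.of_map _ measurable_subtype_coe.aemeasurable ?_
      rw [(MeasurableEmbedding.subtype_coe M.measurableSet_params).map_comap]
      infer_instance
    infer_instance
  refine ⟨tᶜ, fun z => ∫⁻ θ : M.params, ENNReal.ofReal (u θ z * M.prior θ.1)
    ∂(Measure.comap Subtype.val volume), ?_, ?_, ?_⟩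
  · refine Measurable.lintegral_prod_right'
      (f := fun q : (Fin m → Y) × M.params => ENNReal.ofReal (u q.2 q.1 * M.prior q.2.1)) ?_
    refine Measurable.ennreal_ofReal ((hjoint.comp measurable_swap).mul ?_)
    exact M.measurable_prior.comp (measurable_subtype_coe.comp measurable_snd)
  · exact measure_eq_zero_iff_ae_notMem.1 ht0
  · intro z hz
    rw [marginalLikelihood, ← lintegral_subtype_comap M.measurableSet_params]
    refine lintegral_congr fun θ => ?_
    simp only [hu, likelihood, Set.indicator_of_mem (hz _)]

end BayesModel

/-! ### The maximum likelihood estimate, the tail, and the final comparison. -/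

namespace BayesModel

variable {Y : Type*} [MeasurableSpace Y] {p : ℕ} {M : BayesModel Y p}
  {θ₀ : EuclideanSpace ℝ (Fin p)}

/-- The log ratio at a maximizer is nonnegative, whereas outside the ball it is at most `-c' n < 0`.
So the maximizer lies in the ball, where completing the square caps the gain. -/
lemma log_likelihood_sub_mem_Icc_of_isMLE {z : ℕ → Y}
    (hz : ∀ i, ∀ θ ∈ M.params, 0 < M.density θ (z i)) {n : ℕ} (hn : 0 < n) (h₀ : θ₀ ∈ M.params)
    {A c c' δ : ℝ} (hc : 0 < c) (hc' : 0 < c')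
    (hS : ‖∑ i ∈ Finset.range n, M.score θ₀ (z i)‖ ≤ A * √n)
    (hloc : ∀ h, ‖h‖ < δ → ∑ i ∈ Finset.range n, M.logRatio θ₀ (θ₀ + h) (z i) ≤
      (∑ i ∈ Finset.range n, M.score θ₀ (z i)) h - c * n * ‖h‖ ^ 2)
    (hglob : ∀ θ ∈ M.params, δ ≤ ‖θ - θ₀‖ →
      ∑ i ∈ Finset.range n, M.logRatio θ₀ θ (z i) ≤ -c' * n)
    {θ : EuclideanSpace ℝ (Fin p)} (hθ : M.IsMLE (fun i : Fin n => z i) θ) :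
    Real.log (M.likelihood (fun i : Fin n => z i) θ) -
      Real.log (M.likelihood (fun i : Fin n => z i) θ₀) ∈ Set.Icc 0 (A ^ 2 / (2 * c)) := by
  have hn' : (0 : ℝ) < n := by exact_mod_cast hn
  have hL := likelihood_pos hz n h₀
  have hmax : M.likelihood (fun i : Fin n => z i) θ₀ ≤ M.likelihood (fun i : Fin n => z i) θ :=
    hθ.2 h₀
  have h1 := Real.log_le_log hL hmax
  have heq := likelihood_eq_mul_exp hz n h₀ hθ.1
  rw [heq, Real.log_mul hL.ne' (Real.exp_pos _).ne', Real.log_exp] at h1 ⊢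
  have hlt : ‖θ - θ₀‖ < δ := by
    by_contra h
    have := hglob θ hθ.1 (not_lt.1 h)
    nlinarith
  have h2 := hloc (θ - θ₀) hlt
  have h3 := apply_sub_mul_sq_norm_le hc hS (θ - θ₀)
  rw [add_sub_cancel] at h2
  have h4 : 0 ≤ c * n / 2 * ‖θ - θ₀‖ ^ 2 := by positivity
  constructor <;> linarith

lemma abs_log_sub_le_of_bounds {L N a b x d T : ℝ} (hL : 0 < L) (hN : 0 < N) (ha : 0 < a)
    (hx1 : L * a * N ≤ x) (hx2 : x ≤ L * b * N) (hT : T - Real.log L ∈ Set.Icc 0 d) :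
    |Real.log x - (T + Real.log N)| ≤ |Real.log a| + |Real.log b| + d := by
  have hx : 0 < x := lt_of_lt_of_le (by positivity) hx1
  have hb : 0 < b := by
    by_contra h
    have : L * b * N ≤ 0 := by
      have := mul_nonneg (mul_nonneg hL.le (by linarith : (0 : ℝ) ≤ -b)) hN.le
      linarith
    linarith
  have h1 := Real.log_le_log (by positivity) hx1
  have h2 := Real.log_le_log hx hx2
  rw [Real.log_mul (by positivity) hN.ne', Real.log_mul hL.ne' (by positivity)] at h1 h2
  rw [abs_le]
  constructor <;> linarith [hT.1, hT.2, neg_abs_le (Real.log a), le_abs_self (Real.log b),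
    abs_nonneg (Real.log a), abs_nonneg (Real.log b)]

variable {Ω : Type*} [MeasurableSpace Ω] {μ : Measure Ω} {y : ℕ → Ω → Y}

/-- The ratio of marginal likelihood to likelihood for the first `m` observations is a fixed random
variable, almost surely finite, so the exponential factor beats `n^(p/2)`. The truncated subtraction
`n - m` matters only for `n < m`. -/
lemma highProbability_tail_le [IsProbabilityMeasure μ] (hreg : M.RegularAt θ₀)
    (hy : IsIIDSample μ (M.law θ₀) y) {m : ℕ}
    (hm : ∀ᵐ z : Fin m → Y ∂(Measure.pi fun _ => M.law θ₀), M.marginalLikelihood z < ⊤)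
    {c : ℝ} (hc : 0 < c) :
    HighProbability μ fun n ω => M.marginalLikelihood (fun i : Fin m => y i ω) < ⊤ ∧
      (M.marginalLikelihood (fun i : Fin m => y i ω)).toReal *
        (Real.exp (-c * (n - m : ℕ)) / M.likelihood (fun i : Fin m => y i ω) θ₀) ≤
      (n : ℝ) ^ (-((p : ℝ) / 2)) := by
  obtain ⟨s, Q, hQm, hs, hQ⟩ := exists_measurable_marginalLikelihood hreg.density_continuousOn m
  have hfin : ∀ᵐ ω ∂μ, M.marginalLikelihood (fun i : Fin m => y i ω) < ⊤ :=
    (hy.measurePreserving_pi (e := fun i : Fin m => (i : ℕ))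
      Fin.val_injective).quasiMeasurePreserving.ae hm
  have hyQ : Measurable fun ω => Q fun i : Fin m => y i ω :=
    hQm.comp (measurable_pi_iff.2 fun i => hy.measurable i)
  have hyL : Measurable fun ω => M.likelihood (fun i : Fin m => y i ω) θ₀ :=
    Finset.measurable_fun_prod _ fun i _ =>
      (M.measurable_density θ₀ hreg.mem_params).comp (hy.measurable i)
  set B : Ω → ℝ := fun ω => (Q fun i : Fin m => y i ω).toReal /
    M.likelihood (fun i : Fin m => y i ω) θ₀ with hB
  have hBm : Measurable B := hyQ.ennreal_toReal.div hyL
  have hlim : Tendsto (fun n : ℕ => Real.exp (-c * (n - m : ℕ)) * (n : ℝ) ^ ((p : ℝ) / 2)) atTop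
      (𝓝 0) := by
    have h1 := ((tendsto_rpow_mul_exp_neg_mul_atTop_nhds_zero ((p : ℝ) / 2) c hc).comp
      tendsto_natCast_atTop_atTop).const_mul (Real.exp (c * m))
    rw [mul_zero] at h1
    refine h1.congr' ?_
    filter_upwards [eventually_ge_atTop m] with n hn
    rw [Nat.cast_sub hn, Function.comp_apply]
    have : Real.exp (-c * ((n : ℝ) - m)) = Real.exp (c * m) * Real.exp (-c * n) := by
      rw [← Real.exp_add]; ring_nf
    rw [this]
    ring
  have hW := HighProbability.of_tendsto_ae_lt (μ := μ)
    (X := fun n ω => B ω * (Real.exp (-c * (n - m : ℕ)) * (n : ℝ) ^ ((p : ℝ) / 2)))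
    (fun n => (hBm.mul_const _).aestronglyMeasurable) zero_lt_one
    (ae_of_all _ fun ω => by simpa using hlim.const_mul (B ω))
  refine hW.mono_ae ?_
  filter_upwards [eventually_gt_atTop 0] with n hn
  filter_upwards [hfin, hy.ae_all hs] with ω hω1 hω2 hω
  refine ⟨hω1, ?_⟩
  have hn' : (0 : ℝ) < n := by exact_mod_cast hn
  have hNpos : 0 < (n : ℝ) ^ ((p : ℝ) / 2) := Real.rpow_pos_of_pos hn' _
  rw [Real.rpow_neg hn'.le, ← one_div, le_div_iff₀ hNpos]
  refine le_trans (le_of_eq ?_) hω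
  rw [hB, ← hQ _ fun i => hω2 i]
  ring

/-- The Laplace bounds for the marginal likelihood when the score is of order `√n`. -/
lemma exists_highProbability_abs_log_marginalLikelihood_le [IsProbabilityMeasure μ]
    (hreg : M.RegularAt θ₀) (hy : IsIIDSample μ (M.law θ₀) y) (A : ℝ) :
    ∃ C, HighProbability μ fun n ω =>
      ‖∑ i ∈ Finset.range n, M.score θ₀ (y i ω)‖ ≤ A * √n →
      (0 < M.marginalLikelihood (fun i : Fin n => y i ω) ∧
        M.marginalLikelihood (fun i : Fin n => y i ω) < ⊤) ∧
      ∀ θ, M.IsMLE (fun i : Fin n => y i ω) θ →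
        |Real.log (M.marginalLikelihood (fun i : Fin n => y i ω)).toReal -
          (Real.log (M.likelihood (fun i : Fin n => y i ω) θ) - (p : ℝ) / 2 * Real.log n)| ≤ C := by
  have h₀ := hreg.mem_params
  obtain ⟨r, hr, hsub, H, hH, hsm⟩ := hreg.smooth
  obtain ⟨m, hm⟩ := hreg.marginal_finite
  obtain ⟨δ₁, hδ₁, c, hc, hW1⟩ :=
    exists_highProbability_sum_logRatio_le_of_norm_lt hy hr hsub hH hsm hreg.fisher_posDef
  obtain ⟨C, hC, hW2⟩ := highProbability_le_sum_logRatio hy hH hsm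
  have hg := hreg.prior_pos
  obtain ⟨δ₂, hδ₂, hprior⟩ := Metric.continuousAt_iff.1 hreg.prior_continuousAt (M.prior θ₀ / 2)
    (half_pos hg)
  set δ := min δ₁ (min δ₂ r) with hδ_def
  have hδ : 0 < δ := lt_min hδ₁ (lt_min hδ₂ hr)
  have hδδ₁ : δ ≤ δ₁ := min_le_left _ _
  have hδδ₂ : δ ≤ δ₂ := (min_le_right _ _).trans (min_le_left _ _)
  have hδr : δ ≤ r := (min_le_right _ _).trans (min_le_right _ _)
  have hprior' : ∀ θ ∈ Metric.ball θ₀ δ, M.prior θ₀ / 2 ≤ M.prior θ ∧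
      M.prior θ ≤ 2 * M.prior θ₀ := by
    intro θ hθ
    have h1 := hprior ((Metric.mem_ball.1 hθ).trans_le hδδ₂)
    rw [Real.dist_eq, abs_lt] at h1
    constructor <;> linarith
  obtain ⟨c₁, hc₁, hW3⟩ := highProbability_sum_logRatio_le_of_le_norm hreg hy hδ
  -- The tail integral needs the global bound for the observations after the first `m`, which again
  -- form a sample from the same law.
  obtain ⟨c₂, hc₂, hW4⟩ := highProbability_sum_logRatio_le_of_le_norm hreg (hy.shift m) hδ
  have hW5 := highProbability_tail_le hreg hy hm hc₂
  set a := M.prior θ₀ / 2 * Real.exp (-A - C) *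
    (volume (Metric.ball (0 : EuclideanSpace ℝ (Fin p)) 1)).toReal with ha_def
  -- The summand `1` accounts for the contribution from outside the ball, which is at most `L(θ₀)
  -- n^(-p/2)`.
  set b := 2 * M.prior θ₀ * Real.exp (A ^ 2 / (2 * c)) * (2 * Real.pi / c) ^ ((p : ℝ) / 2) + 1
    with hb_def
  have ha : 0 < a := by
    have hv : 0 < (volume (Metric.ball (0 : EuclideanSpace ℝ (Fin p)) 1)).toReal :=
      ENNReal.toReal_pos (Metric.measure_ball_pos _ _ one_pos).ne' measure_ball_lt_top.ne
    positivity
  refine ⟨|Real.log a| + |Real.log b| + A ^ 2 / (2 * c),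
    ((hW1.and hW2).and (hW3.and ((hW4.comp_tendsto (tendsto_sub_atTop_nat m)).and hW5))).mono_ae ?_⟩
  have hsqrt : Tendsto (fun n : ℕ => 1 / √(n : ℝ)) atTop (𝓝 0) :=
    tendsto_const_nhds.div_atTop (Real.tendsto_sqrt_atTop.comp tendsto_natCast_atTop_atTop)
  filter_upwards [eventually_gt_atTop 0, eventually_ge_atTop m, (tendsto_order.1 hsqrt).2 δ hδ]
    with n hn hmn hnδ
  filter_upwards [hy.ae_all hreg.density_pos] with ω hz hω hS
  obtain ⟨⟨hω1, hω2⟩, hω3, hω4, hω5, hω6⟩ := hω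
  have hn' : (0 : ℝ) < n := by exact_mod_cast hn
  set N := (n : ℝ) ^ (-((p : ℝ) / 2)) with hN_def
  have hN : 0 < N := Real.rpow_pos_of_pos hn' _
  have hL := likelihood_pos hz n h₀
  have hin := lintegral_ball_le hz hn h₀ (b := 2 * M.prior θ₀) hc (by positivity)
    (fun θ hθ => (hprior' θ hθ).2) hS fun h hh => hω1 h (hh.trans_le hδδ₁)
  have hlow := le_marginalLikelihood hz hn h₀ (b := M.prior θ₀ / 2) hC (by positivity)
    ((Metric.ball_subset_ball hδr).trans hsub) hnδ.le (fun θ hθ => (hprior' θ hθ).1) hS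
    fun h hh => hω2 h (hh.trans_le hδr)
  have hout : ∫⁻ θ in M.params \ Metric.ball θ₀ δ,
      ENNReal.ofReal (M.likelihood (fun i : Fin n => y i ω) θ * M.prior θ) ≤
      ENNReal.ofReal (M.likelihood (fun i : Fin n => y i ω) θ₀ * N) := by
    obtain ⟨k, rfl⟩ := Nat.exists_eq_add_of_le hmn
    rw [Nat.add_sub_cancel_left] at hω4 hω6
    refine (lintegral_diff_ball_le (z := fun i => y i ω) hz h₀ hω4).trans ?_
    have hLm := likelihood_pos hz m h₀
    rw [← ENNReal.ofReal_toReal hω5.ne, ← ENNReal.ofReal_mul (by positivity)]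
    refine ENNReal.ofReal_le_ofReal ?_
    calc _ = M.likelihood (fun i : Fin (m + k) => y i ω) θ₀ *
          ((M.marginalLikelihood fun i : Fin m => y i ω).toReal *
            (Real.exp (-c₂ * k) / M.likelihood (fun i : Fin m => y i ω) θ₀)) := by ring
      _ ≤ _ := by gcongr
  set L₀ := M.likelihood (fun i : Fin n => y i ω) θ₀ with hL₀
  have hup : M.marginalLikelihood (fun i : Fin n => y i ω) ≤ ENNReal.ofReal (L₀ * b * N) := by
    rw [marginalLikelihood, ← lintegral_inter_add_sdiff _ M.params
      (measurableSet_ball (x := θ₀) (ε := δ))]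
    refine (add_le_add hin hout).trans_eq ?_
    rw [← ENNReal.ofReal_add (by positivity) (by positivity)]
    congr 1
    rw [hb_def]
    ring
  have hfin : M.marginalLikelihood (fun i : Fin n => y i ω) < ⊤ :=
    hup.trans_lt ENNReal.ofReal_lt_top
  have hpos : 0 < M.marginalLikelihood (fun i : Fin n => y i ω) :=
    lt_of_lt_of_le (ENNReal.ofReal_pos.2 (by positivity)) hlow
  refine ⟨⟨hpos, hfin⟩, fun θ hθ => ?_⟩
  have hT := log_likelihood_sub_mem_Icc_of_isMLE (z := fun i => y i ω) hz hn h₀ hc hc₁ hS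
    (fun h hh => hω1 h (hh.trans_le hδδ₁)) hω3 hθ
  have hx1 : L₀ * a * N ≤ (M.marginalLikelihood (fun i : Fin n => y i ω)).toReal :=
    (ENNReal.ofReal_le_iff_le_toReal hfin.ne).1 hlow
  have hx2 : (M.marginalLikelihood (fun i : Fin n => y i ω)).toReal ≤ L₀ * b * N :=
    ENNReal.toReal_le_of_le_ofReal (by positivity) hup
  have hfinal := abs_log_sub_le_of_bounds hL hN ha hx1 hx2 hT
  rw [hN_def, Real.log_rpow hn'] at hfinal
  convert hfinal using 2
  ring

end BayesModel

theorem theorem1 {p : ℕ} {Y : Type*} [MeasurableSpace Y] (M : BayesModel Y p)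
    (θ₀ : EuclideanSpace ℝ (Fin p)) (hreg : M.RegularAt θ₀)
    {Ω : Type*} [MeasurableSpace Ω] (μ : Measure Ω) [IsProbabilityMeasure μ]
    (y : ℕ → Ω → Y) (hmeas : ∀ i, Measurable (y i)) (hindep : iIndepFun y μ)
    (hlaw : ∀ i, μ.map (y i) = M.law θ₀)
    (θhat : ℕ → Ω → EuclideanSpace ℝ (Fin p))
    (hMLE : Tendsto (fun n : ℕ => μ {ω | ¬ M.IsMLE (fun i : Fin n => y i ω) (θhat n ω)})
      atTop (𝓝 0)) :
    Tendsto (fun n : ℕ => μ {ω | ¬ (0 < M.marginalLikelihood (fun i : Fin n => y i ω) ∧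
        M.marginalLikelihood (fun i : Fin n => y i ω) < ⊤)}) atTop (𝓝 0) ∧
    BoundedInProbability μ (fun n ω =>
      Real.log (M.marginalLikelihood (fun i : Fin n => y i ω)).toReal -
        (Real.log (M.likelihood (fun i : Fin n => y i ω) (θhat n ω)) -
          (p : ℝ) / 2 * Real.log n)) := by
  have hy : IsIIDSample μ (M.law θ₀) y := ⟨hmeas, hindep, hlaw⟩
  obtain ⟨r, hr, hsub, H, hH, hsm⟩ := hreg.smooth
  have hscore := BayesModel.memLp_score_and_integral_score hr hsub hreg.density_pos hH hsm
  -- `C` depends on `ε` through the score bound `A`: half of `ε` is spent on the score exceeding `A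
  -- √n`, half on the events whose failure probability tends to zero. The positivity and finiteness
  -- event does not involve `C`, so letting `ε` vary gives the first conclusion too.
  have key : ∀ ε : ENNReal, 0 < ε → ∃ C, ∀ᶠ n in atTop,
      μ {ω | ¬ ((0 < M.marginalLikelihood (fun i : Fin n => y i ω) ∧
        M.marginalLikelihood (fun i : Fin n => y i ω) < ⊤) ∧
        |Real.log (M.marginalLikelihood (fun i : Fin n => y i ω)).toReal -
          (Real.log (M.likelihood (fun i : Fin n => y i ω) (θhat n ω)) -
            (p : ℝ) / 2 * Real.log n)| ≤ C)} ≤ ε := by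
    intro ε hε
    obtain ⟨A, -, hA⟩ := BayesModel.exists_measure_sqrt_lt_norm_sum_score_le hy
      (fun u => (hscore u).1) (fun u => (hscore u).2) (ENNReal.half_pos hε.ne')
    obtain ⟨C, hC⟩ :=
      BayesModel.exists_highProbability_abs_log_marginalLikelihood_le hreg hy A
    have hW := hC.and (show HighProbability μ fun n ω =>
      M.IsMLE (fun i : Fin n => y i ω) (θhat n ω) from hMLE)
    refine ⟨C, ?_⟩
    filter_upwards [eventually_gt_atTop 0,
      (tendsto_order.1 hW).2 _ (ENNReal.half_pos hε.ne')] with n hn hlt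
    rw [← ENNReal.add_halves ε]
    refine le_trans (measure_mono fun ω hω => ?_)
      ((measure_union_le _ _).trans (add_le_add (hA n hn) hlt.le))
    by_contra hcon
    simp only [Set.mem_union, Set.mem_ofPred_eq, not_or, not_lt, not_not] at hcon hω
    obtain ⟨h1, h2, h3⟩ := hcon
    exact hω ⟨(h2 h1).1, (h2 h1).2 _ h3⟩
  constructor
  · rw [ENNReal.tendsto_nhds_zero]
    intro ε hε
    obtain ⟨C, hC⟩ := key ε hε
    filter_upwards [hC] with n hn
    refine le_trans (measure_mono fun ω hω => ?_) hn
    simp only [Set.mem_ofPred_eq] at hω ⊢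
    exact fun h => hω h.1
  · intro ε hε
    obtain ⟨C, hC⟩ := key ε hε
    refine ⟨C, ?_⟩
    filter_upwards [hC] with n hn
    refine le_trans (measure_mono fun ω hω => ?_) hn
    simp only [Set.mem_ofPred_eq] at hω ⊢
    exact fun h => not_le.2 hω h.2
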